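/- **Setting.** Three servers $P_0,P_1,P_2$ (indices mod 3) work over $\mathbb{Z}_{2^\ell}$, $\ell\ge 1$, in synchronous rounds with private channels and broadcast; at most one server is malicious; common randomness is sampled without interaction from shared keys. Sending an element of a finite type $X$ costs $\lceil\log_2|X|\rceil$ bits; hash values have $\kappa$ bits. Let $f$ be a monic integer polynomial of degree $d$, irreducible over $\mathbb{Z}_2$; the elements of $R=\mathbb{Z}_{2^\ell}[x]/(f)$ (extended ring elements) cost $\ell d$ bits. A value $v$ is $\llbracket\cdot\rrbracket$-shared if $P_0$ holds $([\alpha]_1,[\alpha]_2,\beta+\gamma)$ and $P_s$ holds $([\alpha]_s,\beta,\gamma)$ for $s=1,2$, where $\alpha=[\alpha]_1+[\alpha]_2$, $\beta=v+\alpha$; a value $v=v_0+v_1+v_2$ is $\langle\cdot\rangle$-shared if $P_s$ holds $(v_s,v_{s+1})$. In joint message passing (jmp) from $P_i,P_j$ to $P_k$, $P_i$ sends the value and, in a verify phase executed once for all values, $P_j$ sends a hash of them, after which inconsistency bits are exchanged and, if necessary, a trusted third party is selected. **Protocol.** Given $m$ dot products $\mathsf z=\vec{\mathbf x}\odot\vec{\mathbf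 y}$ of $\llbracket\cdot\rrbracket$-shared vectors of length $n$, arranged in $T$ layers (entries may be outputs of earlier layers), the preprocessing computes $\langle \mathsf f\rangle$ with $\mathsf f=\vec{\mathbf d}\odot\vec{\mathbf e}$, where $\mathsf d_j=\gamma_{\mathsf x_j}+\alpha_{\mathsf x_j}$, $\mathsf e_j=\gamma_{\mathsf y_j}+\alpha_{\mathsf y_j}$: $P_i$ sends $\mathsf f_i=z_i+\sum_j(\mathsf d_{j,i}\mathsf e_{j,i}+\mathsf d_{j,i}\mathsf e_{j,i+1}+\mathsf d_{j,i+1}\mathsf e_{j,i})$ to $P_{i-1}$ ($z_0+z_1+z_2=0$), and then proves to the other two servers in distributed zero-knowledge fashion that its $m$ messages are correct. The $m$ circuits $c$ (expected minus sent message, $u=4n+2$ inputs) are put into $M<2^d$ groups of at most $L$ ($m\le LM$, missing ones being zero); $g=\sum_k\theta_k c_k$ combines a group; wire polynomials of degree $\le M$ take a random value at the point $0$ and the inputs of the groups at the points $1,\dots,M$ (points with invertible differences in $R$); the prover shares the $2M+1$ coefficients of $p=g(\text{wire polynomials})$; for coins $\eta\in R^M$ and $r\in R\setminus\{1,\dots,M\}$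 tossed afterwards the verifiers check $\sum_a\eta_a p(a)=0$ and the identity defining $p$ at $r$, their message being passed by jmp. In the online phase, with $\psi=\mathsf f_2-\sum_i\gamma_{\mathsf x_i}\gamma_{\mathsf y_i}$, $[\chi]_1=\mathsf f_1$, $[\chi]_2=\mathsf f_0$, the shares $[\beta^\star]_j=-\sum_i((\beta_{\mathsf x_i}+\gamma_{\mathsf x_i})[\alpha_{\mathsf y_i}]_j+(\beta_{\mathsf y_i}+\gamma_{\mathsf y_i})[\alpha_{\mathsf x_i}]_j)+[\alpha_{\mathsf z}]_j+[\chi]_j$ are passed by jmp to $P_2$ ($j=1$) and $P_1$ ($j=2$), who set $\beta_{\mathsf z}=\beta^\star+\sum_i\beta_{\mathsf x_i}\beta_{\mathsf y_i}+\psi$; the values $\beta_{\mathsf z}+\gamma_{\mathsf z}$ are passed by jmp to $P_0$ at the end. **Claim.** 1. *Preprocessing.* In an honest execution the semi-honest part costs $\ell$ bits per server and dot product. The verification costs $uL+2M+3$ elements of $R$ and $\kappa+4$ bits (verify phases of jmp) per server. So the total is $3\ell m+3(uL+2M+3)\ell d+3(\kappa+4)$ bits. The outputs are $\langle\cdot\rangle$-sharings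 of the dot products, all proofs are accepted and no trusted third party is selected. Whatever a malicious server does, the honest servers send at most $3\ell m+3(uL+2M+3)\ell d+3(4\kappa+25)$ bits. 2. *Verification cost.* There is an absolute constant $C$ such that for all $1\le n\le m$ one can choose $L,M$ with $m\le LM$ and $3(uL+2M+3)\le C\sqrt{nm}$. The same bound holds whenever $n,m\ge1$, $uL=2M$ and $LM=m$. 3. *Soundness.* If the output of some $g$ is non-zero for the given $\theta$, every prover is accepted with probability at most $\varepsilon(2M)$ over $\eta,r$, where $\varepsilon(y)=\frac{2^{(\ell-1)d}y+1}{2^{\ell d}-M}$. If some message of the prover is wrong, then for uniform $\theta\in R^L$ all outputs of $g$ vanish with probability at most $2^{-d}$, and every prover is accepted with probability at most $2^{-d}+\varepsilon(2M)$. If $2^\gamma\ge 2M$ then $\varepsilon(2M)\le\varepsilon(2^\gamma)$. For fixed $\ell$, as $\gamma\to\infty$ and $d-\gamma\to\infty$ with $2M\le 2^\gamma$, both $\varepsilon(2^\gamma)$ and $2^{-d}+\varepsilon(2^\gamma)$ are asymptotically equal to $2^{-(d-\gamma)}$. 4. *Amortized preprocessing.* For all $\ell\geq1,\kappa,n$ and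 every $\sigma$ there are parameters $L,M,f$ (depending on $m$) with cheating probability at most $2^{-\sigma}$ for which the total number of bits of the preprocessing divided by $m$ tends to $3\ell$ as $m\to\infty$. The same holds for the maximal number of bits sent by honest servers in the presence of a malicious one. 5. *Online.* The online phase has $T+13$ rounds. In an honest execution, $P_1$ and $P_2$ hold $\beta$ of the outputs of the first $t$ layers after $t$ rounds, all servers end with correct $\llbracket\cdot\rrbracket$-sharings, no trusted third party is selected, and the total is $3\ell m+3(\kappa+4)$ bits. With a malicious server the honest ones send at most $3\ell m+3(4\kappa+25)$ bits. So the amortized cost is $3\ell$ bits per dot product and one round per layer, independently of $n$. -/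

import Mathlib

open Polynomial Filter Topology

namespace DotP3

noncomputable section

/-! ## Synchronous protocols for three servers, and their communication -/

/-- The servers `P_0, P_1, P_2`; indices are added modulo 3. -/
abbrev Srv := Fin 3

/-- Bits needed to transmit one element of the finite type `X`: `⌈log₂ |X|⌉`. -/
def bitLen (X : Type) : ℕ := Nat.clog 2 (Nat.card X)

/-- One synchronous round. `Priv p q` is the type of the messages from `P_p` to `P_q` over the private
channel, `Bc p` that of the messages `P_p` may broadcast; `none` means silence. A server acts on its
own local state only. -/
structure Round (S : Type) where
  Priv : Srv → Srv → Type
  Bc : Srv → Type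
  send : (p q : Srv) → S → Option (Priv p q)
  bcast : (p : Srv) → S → Option (Bc p)
  recv : (p : Srv) → S → ((q : Srv) → Option (Priv q p)) → ((q : Srv) → Option (Bc q)) → S

/-- A malicious adversary corrupting at most one server. The messages of the corrupted server are
arbitrary functions of the round, of the number of rounds left and of the states of all servers. -/
structure Adversary (S : Type) where
  corrupt : Option Srv
  priv : (R : Round S) → ℕ → (Srv → S) → (p q : Srv) → Option (R.Priv p q)
  bc : (R : Round S) → ℕ → (Srv → S) → (p : Srv) → Option (R.Bc p)

/-- The adversary that corrupts nobody. -/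
def honest (S : Type) : Adversary S where
  corrupt := none
  priv _ _ _ _ _ := none
  bc _ _ _ _ := none

variable {S : Type}

def Adversary.outPriv (A : Adversary S) (R : Round S) (k : ℕ) (σ : Srv → S) (p q : Srv) :
    Option (R.Priv p q) :=
  if A.corrupt = some p then A.priv R k σ p q else R.send p q (σ p)

def Adversary.outBc (A : Adversary S) (R : Round S) (k : ℕ) (σ : Srv → S) (p : Srv) :
    Option (R.Bc p) :=
  if A.corrupt = some p then A.bc R k σ p else R.bcast p (σ p)

/-- The states of the servers after a round. -/
def step (A : Adversary S) (R : Round S) (k : ℕ) (σ : Srv → S) : Srv → S := fun p =>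
  R.recv p (σ p) (fun q => A.outPriv R k σ q p) (fun q => A.outBc R k σ q)

/-- The number of bits that `P_p` communicates in a round if it is honest. -/
def roundBits (A : Adversary S) (R : Round S) (σ : Srv → S) (p : Srv) : ℕ :=
  if A.corrupt = some p then 0 else
    (∑ q : Srv, if q ≠ p ∧ (R.send p q (σ p)).isSome then bitLen (R.Priv p q) else 0) +
      (if (R.bcast p (σ p)).isSome then bitLen (R.Bc p) else 0)

/-- The states of the servers after a sequence of rounds. -/
def run (A : Adversary S) : List (Round S) → (Srv → S) → (Srv → S)
  | [], σ => σ
  | R :: Rs, σ => run A Rs (step A R Rs.length σ)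

/-- The number of bits communicated by each honest server in a sequence of rounds. -/
def bits (A : Adversary S) : List (Round S) → (Srv → S) → Srv → ℕ
  | [], _ => fun _ => 0
  | R :: Rs, σ => fun p => roundBits A R σ p + bits A Rs (step A R Rs.length σ) p

/-- The number of bits communicated by all honest servers together. -/
def totalBits (A : Adversary S) (Rs : List (Round S)) (σ : Srv → S) : ℕ := ∑ p : Srv, bits A Rs σ p

/-- A total cost `total m` of `m` instances amounts to the amortized cost `c` per instance. -/
def Amortizes (total : ℕ → ℕ) (c : ℝ) : Prop :=
  Tendsto (fun m : ℕ => (total m : ℝ) / m) atTop (𝓝 c)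

/-! ## Joint message passing -/

/-- Hash values of `κ` bits. -/
abbrev Dig (κ : ℕ) := Fin κ → Bool

/-- A broadcast accusation: the set of accused servers. -/
abbrev Acc := Srv → Bool

/-- What a server remembers during the verify phase of joint message passing: the hash received from
`P_j`, its inconsistency bit, the bit received from the fellow sender, and the selected trusted third
party. Once a trusted third party is selected, the protocol has terminated. -/
structure Jmp (κ : ℕ) where
  hash : Option (Dig κ)
  bit : Option Bool
  fellow : Option Bool
  ttp : Option Srv

def Jmp.start (κ : ℕ) : Jmp κ := ⟨none, none, none, none⟩

/-- Whether the broadcast `m` accuses `P_q`. -/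
def accuses (m : Option Acc) (q : Srv) : Bool := (m.getD fun _ => false) q

/-- The accusation of the servers `q` with `a q = true`, if there are any. -/
def accusation (a : Acc) : Option Acc := if ∃ q, a q = true then some a else none

section
variable {V : Type} {κ : ℕ}

/-- `P_j` sends the hash of the value to `P_k`. -/
def jmpHash (j k : Srv) (hash : V → Dig κ) (val : Srv → S → Option V)
    (get : S → Jmp κ) (put : S → Jmp κ → S) : Round S where
  Priv _ _ := Dig κ
  Bc _ := Empty
  send p q s := if (get s).ttp = none ∧ p = j ∧ q = k then (val p s).map hash else none
  bcast _ _ := none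
  recv p s inb _ := put s
    ⟨if p = k then inb j else none, none, none, (get s).ttp⟩

/-- The inconsistency bit of the receiver; `none` if one of the senders was silent. -/
def inconsistent (hash : V → Dig κ) (v : Option V) (h : Option (Dig κ)) : Option Bool :=
  match v, h with
  | some v, some h => some (decide (hash v ≠ h))
  | _, _ => none

/-- `P_k` accuses the silent senders, or else sends its inconsistency bit to both senders. -/
def jmpBit (i j k : Srv) (hash : V → Dig κ) (val : Srv → S → Option V)
    (get : S → Jmp κ) (put : S → Jmp κ → S) : Round S where
  Priv _ _ := Bool
  Bc _ := Acc
  send p q s :=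
    if (get s).ttp = none ∧ p = k ∧ (q = i ∨ q = j) then inconsistent hash (val p s) (get s).hash
    else none
  bcast p s :=
    if (get s).ttp = none ∧ p = k then
      accusation fun q => (decide (q = i) && (val p s).isNone) || (decide (q = j) && (get s).hash.isNone)
    else none
  recv p s inb bc := put s
    { get s with
      bit := if p = k then inconsistent hash (val p s) (get s).hash else inb k
      ttp := if (get s).ttp ≠ none then (get s).ttp
        else if accuses (bc k) j then some i
        else if accuses (bc k) i then some j
        else none }

/-- A sender without a bit from `P_k` accuses `P_k`; otherwise the senders exchange their bits. -/
def jmpExchange (i j k : Srv) (get : S → Jmp κ) (put : S → Jmp κ → S) : Round S where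
  Priv _ _ := Bool
  Bc _ := Acc
  send p q s :=
    if (get s).ttp = none ∧ ((p = i ∧ q = j) ∨ (p = j ∧ q = i)) then (get s).bit else none
  bcast p s :=
    if (get s).ttp = none ∧ (p = i ∨ p = j) ∧ (get s).bit = none then
      accusation fun q => decide (q = k)
    else none
  recv p s inb bc := put s
    { get s with
      fellow := if p = i then inb j else if p = j then inb i else none
      ttp := if (get s).ttp ≠ none then (get s).ttp
        else if accuses (bc j) k then some i
        else if accuses (bc i) k then some j
        else none }

/-- The hash in a broadcast of the last round. -/
def bcHash (m : Option (Dig κ ⊕ Acc)) : Option (Dig κ) := m.bind Sum.getLeft?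

/-- The accusation in a broadcast of the last round. -/
def bcAcc (m : Option (Dig κ ⊕ Acc)) : Option Acc := m.bind Sum.getRight?

/-- The choice of the trusted third party from the broadcast hashes. -/
def pickTTP (i j k : Srv) (hi hj hk : Option (Dig κ)) : Option Srv :=
  if hk = none then none
  else if hi = none ∨ hj = none then some k
  else if hi ≠ hj then some k
  else if hi ≠ hk then some j
  else some i

/-- A sender without a bit from its fellow accuses it; otherwise every server with its inconsistency
bit on broadcasts the hash of its value, and the trusted third party is chosen. -/
def jmpResolve (i j k : Srv) (hash : V → Dig κ) (val : Srv → S → Option V)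
    (get : S → Jmp κ) (put : S → Jmp κ → S) : Round S where
  Priv _ _ := Empty
  Bc _ := Dig κ ⊕ Acc
  send _ _ _ := none
  bcast p s :=
    if (get s).ttp ≠ none then none
    else if p = k then
      if (get s).bit = some true then (val p s).map (Sum.inl ∘ hash) else none
    else if (get s).fellow = none then
      (accusation fun q => decide (p = i ∧ q = j ∨ p = j ∧ q = i)).map Sum.inr
    else if (get s).bit = some true ∨ (get s).fellow = some true then
      (val p s).map (Sum.inl ∘ hash)
    else none
  recv _ s _ bc := put s
    { get s with
      ttp := if (get s).ttp ≠ none then (get s).ttp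
        else if accuses (bcAcc (bc i)) j || accuses (bcAcc (bc j)) i then some k
        else pickTTP i j k (bcHash (bc i)) (bcHash (bc j)) (bcHash (bc k)) }

/-- The verify phase of joint message passing: `P_i` has sent the common value of `P_i, P_j` to `P_k`.
`val p` extracts from the state of `P_p` the value that `P_p` holds (for `P_k`: the value it received,
`none` if `P_i` was silent); `get` and `put` give access to the record of this phase in the state. -/
def jmpVerify (i j k : Srv) (hash : V → Dig κ) (val : Srv → S → Option V)
    (get : S → Jmp κ) (put : S → Jmp κ → S) : List (Round S) :=
  [jmpHash j k hash val get put, jmpBit i j k hash val get put, jmpExchange i j k get put,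
    jmpResolve i j k hash val get put]

end

/-! ## Robust dot products in the preprocessing -/

/-- Parameters: ring size `ℓ`, hash length `κ`, vector length `n`, number `m` of dot products, number
`L` of dot products per group, number `M` of groups, and the polynomial `f` defining the extended
ring. -/
structure Par where
  ℓ : ℕ
  κ : ℕ
  n : ℕ
  m : ℕ
  L : ℕ
  M : ℕ
  f : ℤ[X]

namespace Par

/-- The ring `ℤ/2^ℓ`. -/
abbrev Z (P : Par) : Type := ZMod (2 ^ P.ℓ)

/-- The degree of the extension. -/
abbrev d (P : Par) : ℕ := P.f.natDegree

/-- The extended ring `(ℤ/2^ℓ)[x]/f(x)`. -/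
abbrev E (P : Par) : Type := AdjoinRoot (P.f.map (Int.castRingHom (ZMod (2 ^ P.ℓ))))

/-- `f` is monic and irreducible over `ℤ/2`, the groups contain all dot products (a partial last group
is filled up with zeros), and the extended ring has enough evaluation points. -/
structure Valid (P : Par) : Prop where
  ring : 1 ≤ P.ℓ
  monic : P.f.Monic
  irred : Irreducible (P.f.map (Int.castRingHom (ZMod 2)))
  groups : P.m ≤ P.L * P.M
  points : P.M < 2 ^ P.d

/-- The number of inputs of the circuit that checks one dot product. -/
abbrev u (P : Par) : ℕ := 4 * P.n + 2

end Par

/-- The `4n + 2` input wires of the circuit `c`: `inl (0, j), …, inl (3, j)` carry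
`d_{j,i}, d_{j,i+1}, e_{j,i}, e_{j,i+1}`, `inr 0` carries the share `z_i` of zero and `inr 1` the
message `f_i`. -/
abbrev Slot (n : ℕ) := (Fin 4 × Fin n) ⊕ Fin 2

/-- The circuit `c`: difference of the expected and the actual message of `P_i`. -/
def cCirc {R : Type} [CommRing R] {n : ℕ} (x : Slot n → R) : R :=
  x (.inr 0) + (∑ j : Fin n, (x (.inl (0, j)) * x (.inl (2, j)) + x (.inl (0, j)) * x (.inl (3, j)) +
    x (.inl (1, j)) * x (.inl (2, j)))) - x (.inr 1)

/-- The circuit `g`: random linear combination of `L` circuits `c`. -/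
def gCirc {R : Type} [CommRing R] {n L : ℕ} (θ : Fin L → R) (x : Fin L → Slot n → R) : R :=
  ∑ k : Fin L, θ k * cCirc (x k)

section
variable (P : Par)

/-- The evaluation points `0, 1, …` of the extended ring: the point number `a` is the polynomial in the
root of `f` whose coefficients are the binary digits of `a`. -/
def pt (a : ℕ) : P.E :=
  ∑ b ∈ Finset.range P.d, if a.testBit b then AdjoinRoot.root _ ^ b else 0

/-- Lagrange basis polynomial of the point `a` for the points `0, …, M`. -/
def lagr (a : ℕ) : P.E[X] :=
  ∏ b ∈ (Finset.range (P.M + 1)).erase a, (C (Ring.inverse (pt P a - pt P b)) * (X - C (pt P b)))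

/-- The inputs of the dot products, embedded into the extended ring and arranged in groups. -/
def grouped (x : Fin P.m → Slot P.n → P.Z) (a : Fin P.M) (k : Fin P.L) (s : Slot P.n) : P.E :=
  if h : a * P.L + k < P.m then AdjoinRoot.of _ (x ⟨a * P.L + k, h⟩ s) else 0

/-- The polynomials of degree at most `M`, one for each input wire of `g`, with the value `b` at the
point `0` and the inputs of the `a`-th group at the point `a ∈ {1, …, M}`. -/
def wirePoly (b : Fin P.L → Slot P.n → P.E) (x : Fin P.m → Slot P.n → P.Z) (k : Fin P.L)
    (s : Slot P.n) : P.E[X] :=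
  C (b k s) * lagr P 0 + ∑ a : Fin P.M, C (grouped P x a k s) * lagr P (a + 1)

/-- The polynomial `p = g(f_1, …, f_{uL})` of degree at most `2M`. -/
def proofPoly (θ : Fin P.L → P.E) (b : Fin P.L → Slot P.n → P.E) (x : Fin P.m → Slot P.n → P.Z) :
    P.E[X] :=
  gCirc (fun k => C (θ k)) (wirePoly P b x)

/-- The message of a verifier: shares of `∑ η_a p(a)`, of `p(r)` and of all `f_j(r)`. -/
abbrev VMsg : Type := P.E × P.E × (Fin P.L → Slot P.n → P.E)

/-- The message that a verifier computes from its shares `c` of the coefficients of `p`, `b` of the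
values at the point `0`, `x` of the inputs, and from the public coins `η`, `r`. -/
def vMsg (η : Fin P.M → P.E) (r : P.E) (c : Fin (2 * P.M + 1) → P.E)
    (b : Fin P.L → Slot P.n → P.E) (x : Fin P.m → Slot P.n → P.Z) : VMsg P :=
  let p : P.E[X] := ∑ t : Fin (2 * P.M + 1), C (c t) * X ^ (t : ℕ)
  (∑ a : Fin P.M, η a * p.eval (pt P (a + 1)), p.eval r, fun k s => (wirePoly P b x k s).eval r)

/-- The decision on two complementary messages: `∑ η_a p(a) = 0` and `p(r) = g(f_1(r), …)`. -/
def accept (θ : Fin P.L → P.E) (v w : VMsg P) : Prop :=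
  v.1 + w.1 = 0 ∧ v.2.1 + w.2.1 = gCirc θ (fun k s => v.2.2 k s + w.2.2 k s)

/-- Local state of a server `P_p` when dot products of replicated shared vectors are computed. -/
structure PreSt where
  /-- `dLo, dHi` are the shares `p` and `p + 1` of the vectors `d`. -/
  dLo : Fin P.m → Fin P.n → P.Z
  dHi : Fin P.m → Fin P.n → P.Z
  /-- `eLo, eHi` are the shares `p` and `p + 1` of the vectors `e`. -/
  eLo : Fin P.m → Fin P.n → P.Z
  eHi : Fin P.m → Fin P.n → P.Z
  /-- Randomness common with `P_{p+1}` and with `P_{p-1}`, for sharings of zero. -/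
  zNext : Fin P.m → P.Z
  zPrev : Fin P.m → P.Z
  /-- As prover: shares of the `f_j(0)` common with the verifier `P_{p+1}` and with `P_{p-1}`. -/
  bNext : Fin P.L → Slot P.n → P.E
  bPrev : Fin P.L → Slot P.n → P.E
  /-- As prover: shares of the coefficients of `p` common with `P_{p-1}`. -/
  cPrev : Fin (2 * P.M + 1) → P.E
  /-- As verifier of `P_{p-1}`: the share of the `f_j(0)`. -/
  bOfPrev : Fin P.L → Slot P.n → P.E
  /-- As verifier of `P_{p+1}`: the shares of the `f_j(0)` and of the coefficients. -/
  bOfNext : Fin P.L → Slot P.n → P.E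
  cOfNext : Fin (2 * P.M + 1) → P.E
  /-- Coins known to all servers, for each prover. -/
  θ : Srv → Fin P.L → P.E
  η : Srv → Fin P.M → P.E
  r : Srv → P.E
  /-- The shares `p` and `p + 1` of the dot products. -/
  fLo : Fin P.m → P.Z
  fHi : Fin P.m → P.Z
  /-- As verifier of `P_{p-1}`: the received share of the coefficients. -/
  cOfPrev : Fin (2 * P.M + 1) → P.E
  /-- As verifier of `P_{p+1}`: the received message of the other verifier. -/
  msg : Option (VMsg P)
  jmp : Jmp P.κ

/-- The randomness that the servers sample without interaction from their common keys: `z s` is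
common to `P_s, P_{s+1}`; `bNext i` to `P_i, P_{i+1}`; `bPrev i`, `c i` to `P_i, P_{i-1}`; the
remaining coins are common to all servers. -/
structure Tape where
  z : Srv → Fin P.m → P.Z
  bNext : Srv → Fin P.L → Slot P.n → P.E
  bPrev : Srv → Fin P.L → Slot P.n → P.E
  c : Srv → Fin (2 * P.M + 1) → P.E
  θ : Srv → Fin P.L → P.E
  η : Srv → Fin P.M → P.E
  r : Srv → P.E

variable {P}

/-- The initial state of `P_p` on vectors with the additive shares `d s`, `e s`, `s = 0, 1, 2`. -/
def preInit (dv ev : Srv → Fin P.m → Fin P.n → P.Z) (τ : Tape P) (p : Srv) : PreSt P where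
  dLo := dv p
  dHi := dv (p + 1)
  eLo := ev p
  eHi := ev (p + 1)
  zNext := τ.z p
  zPrev := τ.z (p - 1)
  bNext := τ.bNext p
  bPrev := τ.bPrev p
  cPrev := τ.c p
  bOfPrev := τ.bNext (p - 1)
  bOfNext := τ.bPrev (p + 1)
  cOfNext := τ.c (p + 1)
  θ := τ.θ
  η := τ.η
  r := τ.r
  fLo := 0
  fHi := 0
  cOfPrev := 0
  msg := none
  jmp := Jmp.start P.κ

/-- The message of a server in the semi-honest protocol, its additive share of the dot products. -/
def PreSt.share (s : PreSt P) (k : Fin P.m) : P.Z :=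
  (s.zNext k - s.zPrev k) +
    ∑ j : Fin P.n, (s.dLo k j * s.eLo k j + s.dLo k j * s.eHi k j + s.dHi k j * s.eLo k j)

/-- The semi-honest dot products: `P_i` sends its shares to `P_{i-1}`. -/
def semiHonest : Round (PreSt P) where
  Priv _ _ := Fin P.m → P.Z
  Bc _ := Empty
  send p q s := if q = p - 1 then some s.share else none
  bcast _ _ := none
  recv p s inb _ := { s with fLo := s.share, fHi := (inb (p + 1)).getD 0 }

/-- Assignment of values to the input wires of `c`. -/
def slots {n : ℕ} {R : Type} (d₀ d₁ e₀ e₁ : Fin n → R) (z f : R) : Slot n → R :=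
  Sum.elim (fun t => (![d₀, d₁, e₀, e₁] t.1) t.2) ![z, f]

/-- The inputs of `c` for the prover. -/
def PreSt.xProver (s : PreSt P) (k : Fin P.m) : Slot P.n → P.Z :=
  slots (s.dLo k) (s.dHi k) (s.eLo k) (s.eHi k) (s.zNext k - s.zPrev k) (s.fLo k)

/-- The additive share of the inputs of `P_{p-1}` that `P_p` holds. -/
def PreSt.xOfPrev (s : PreSt P) (k : Fin P.m) : Slot P.n → P.Z :=
  slots 0 (s.dLo k) 0 (s.eLo k) (s.zPrev k) 0

/-- The additive share of the inputs of `P_{p+1}` that `P_p` holds. -/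
def PreSt.xOfNext (s : PreSt P) (k : Fin P.m) : Slot P.n → P.Z :=
  slots (s.dHi k) 0 (s.eHi k) 0 (-s.zNext k) (s.fHi k)

/-- The share `xOfPrev` of the verifier `P_{p+1}`, as known to the prover `P_p`. -/
def PreSt.xNextKnown (s : PreSt P) (k : Fin P.m) : Slot P.n → P.Z :=
  slots 0 (s.dHi k) 0 (s.eHi k) (s.zNext k) 0

/-- The share of the coefficients of `p` that the prover `P_i` sends to `P_{i+1}`. -/
def PreSt.proof (i : Srv) (s : PreSt P) (t : Fin (2 * P.M + 1)) : P.E :=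
  (proofPoly P (s.θ i) (fun k w => s.bNext k w + s.bPrev k w) s.xProver).coeff t - s.cPrev t

/-- The prover `P_i` sends the proof to `P_{i+1}`; the complementary shares are common randomness of
`P_i` and `P_{i-1}`. -/
def proofRound (i : Srv) : Round (PreSt P) where
  Priv _ _ := Fin (2 * P.M + 1) → P.E
  Bc _ := Empty
  send p q s := if s.jmp.ttp = none ∧ p = i ∧ q = i + 1 then some (s.proof i) else none
  bcast _ _ := none
  recv p s inb _ := if p = i + 1 then { s with cOfPrev := (inb i).getD 0 } else s

/-- The value of the joint message to the verifier `P_{i-1}`, as held by each server. -/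
def verifierValue (i : Srv) (p : Srv) (s : PreSt P) : Option (VMsg P) :=
  if p = i + 1 then some (vMsg P (s.η i) (s.r i) s.cOfPrev s.bOfPrev s.xOfPrev)
  else if p = i then some (vMsg P (s.η i) (s.r i) (s.proof i) s.bNext s.xNextKnown)
  else s.msg

/-- The verifier `P_{i+1}` sends its message to the verifier `P_{i-1}`. -/
def verifierRound (i : Srv) : Round (PreSt P) where
  Priv _ _ := VMsg P
  Bc _ := Empty
  send p q s :=
    if s.jmp.ttp = none ∧ p = i + 1 ∧ q = i - 1 then verifierValue i p s else none
  bcast _ _ := none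
  recv p s inb _ := if p = i - 1 then { s with msg := inb (i + 1) } else s

/-- `P_i` proves the correctness of its messages to `P_{i-1}` and `P_{i+1}`; the message to the
deciding verifier `P_{i-1}` is passed jointly by `P_{i+1}` and `P_i`. -/
def proveRounds (hash : VMsg P → Dig P.κ) (i : Srv) : List (Round (PreSt P)) :=
  [proofRound i, verifierRound i] ++
    jmpVerify (i + 1) i (i - 1) hash (verifierValue i) PreSt.jmp (fun s J => { s with jmp := J })

/-- The verification phase: every server proves once. -/
def verification (hash : VMsg P → Dig P.κ) : List (Round (PreSt P)) :=
  proveRounds hash 0 ++ proveRounds hash 1 ++ proveRounds hash 2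

/-- The robust dot product protocol of the preprocessing. -/
def dotPPre (hash : VMsg P → Dig P.κ) : List (Round (PreSt P)) :=
  semiHonest :: verification hash

/-- The output of the verification of `P_{p+1}`, as computed by `P_p`. -/
def PreSt.accepts (p : Srv) (s : PreSt P) : Prop :=
  ∃ v, s.msg = some v ∧
    accept P (s.θ (p + 1)) v (vMsg P (s.η (p + 1)) (s.r (p + 1)) s.cOfNext s.bOfNext s.xOfNext)

end

/-! ## Cheating provers -/

/-- Uniform probability on a finite type. -/
def prob {Ω : Type} (A : Set Ω) : ℝ := (Nat.card A : ℝ) / Nat.card Ω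

section
variable (P : Par)

/-- The possible values of the coin `r`: the extended ring without the points `1, …, M`. -/
abbrev EvalPt : Type := {r : P.E // ∀ a : Fin P.M, r ≠ pt P (a + 1)}

/-- The verifiers `P_{i+1}, P_{i-1}` of a prover `P_i` hold the shares `x, x'` of the inputs of the
circuits `c` (which include the message sent by `P_i`) and the shares `b, b'` of the values at the point `0`;
`c` is the share received from the prover and `c'` the complementary share of the coefficients. -/
def accepted (θ : Fin P.L → P.E) (η : Fin P.M → P.E) (r : P.E)
    (x x' : Fin P.m → Slot P.n → P.Z) (b b' : Fin P.L → Slot P.n → P.E)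
    (c c' : Fin (2 * P.M + 1) → P.E) : Prop :=
  accept P θ (vMsg P η r c b x) (vMsg P η r c' b' x')

/-- Some message sent by the prover is not the one prescribed by the semi-honest protocol. -/
def Cheats (x x' : Fin P.m → Slot P.n → P.Z) : Prop :=
  ∃ k, cCirc (fun s => x k s + x' k s) ≠ 0

/-- The probability, over `η` and `r`, that the proof is accepted when `θ` is given. -/
def cheatProbGiven (θ : Fin P.L → P.E) (x x' : Fin P.m → Slot P.n → P.Z)
    (b b' : Fin P.L → Slot P.n → P.E) (c c' : Fin (2 * P.M + 1) → P.E) : ℝ :=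
  prob {ω : (Fin P.M → P.E) × EvalPt P | accepted P θ ω.1 ω.2 x x' b b' c c'}

/-- The probability that a prover is accepted that answers the coins `θ` with the proof `c θ`; the
coins `η` and `r` are tossed after the proof is sent. -/
def cheatProb (x x' : Fin P.m → Slot P.n → P.Z) (b b' : Fin P.L → Slot P.n → P.E)
    (c : (Fin P.L → P.E) → Fin (2 * P.M + 1) → P.E) (c' : Fin (2 * P.M + 1) → P.E) : ℝ :=
  prob {ω : (Fin P.L → P.E) × (Fin P.M → P.E) × EvalPt P |
    accepted P ω.1 ω.2.1 ω.2.2 x x' b b' (c ω.1) c'}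

end

/-- The expression `(2^((ℓ-1)d) · y + 1) / (2^(ℓd) - M)`. -/
def errBound (ℓ d M : ℕ) (y : ℝ) : ℝ := (2 ^ ((ℓ - 1) * d) * y + 1) / (2 ^ (ℓ * d) - M)

/-! ## The dot product protocol -/

/-- A circuit of `m` dot product gates on vectors of length `n`, arranged in `T` layers, on `I` input
wires. The wires are the input wires `inl x` and the gate outputs `inr g`. -/
structure DotCircuit (n m T I : ℕ) where
  left : Fin m → Fin n → Fin I ⊕ Fin m
  right : Fin m → Fin n → Fin I ⊕ Fin m
  layer : Fin m → Fin T
  left_lt : ∀ g j g', left g j = .inr g' → layer g' < layer g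
  right_lt : ∀ g j g', right g j = .inr g' → layer g' < layer g

/-- The values `v` on the wires obey all gates. -/
def DotCircuit.Computes {n m T I ℓ : ℕ} (K : DotCircuit n m T I)
    (v : Fin I ⊕ Fin m → ZMod (2 ^ ℓ)) : Prop :=
  ∀ g, v (.inr g) = ∑ j : Fin n, v (K.left g j) * v (K.right g j)

/-- Local state of a server in the online phase. The masks of the wires are
`mask 0 = [α]_2`, `mask 1 = [α]_1`, `mask 2 = γ`, and `P_p` knows `mask p` and `mask (p + 1)`. -/
structure OnSt (ℓ κ m I : ℕ) where
  maskLo : Fin I ⊕ Fin m → ZMod (2 ^ ℓ)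
  maskHi : Fin I ⊕ Fin m → ZMod (2 ^ ℓ)
  /-- Shares `p` and `p + 1` of the outputs of the preprocessing. -/
  fLo : Fin m → ZMod (2 ^ ℓ)
  fHi : Fin m → ZMod (2 ^ ℓ)
  /-- `β` for `P_1` and `P_2`, `β + γ` for `P_0`. -/
  val : Fin I ⊕ Fin m → ZMod (2 ^ ℓ)
  /-- The shares of `β*` used by `P_1` and `P_2`. -/
  star₁ : Fin m → ZMod (2 ^ ℓ)
  star₂ : Fin m → ZMod (2 ^ ℓ)
  /-- Whether an expected value did not arrive. -/
  missing : Bool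
  jmp : Jmp κ

section
variable {n m T I ℓ κ : ℕ} (K : DotCircuit n m T I)

/-- A share of `β*` from the values `β + γ`, the share `a` of `α` and the share `χ`. -/
def starShare (bg a : Fin I ⊕ Fin m → ZMod (2 ^ ℓ)) (χ : Fin m → ZMod (2 ^ ℓ)) (g : Fin m) :
    ZMod (2 ^ ℓ) :=
  -(∑ j : Fin n, (bg (K.left g j) * a (K.right g j) + bg (K.right g j) * a (K.left g j))) +
    a (.inr g) + χ g

/-- The share number 1 of `β*`, computed by `P_1`. -/
def OnSt.star₁P₁ (s : OnSt ℓ κ m I) : Fin m → ZMod (2 ^ ℓ) :=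
  starShare K (fun w => s.val w + s.maskHi w) s.maskLo s.fLo

/-- The share number 2 of `β*`, computed by `P_2`. -/
def OnSt.star₂P₂ (s : OnSt ℓ κ m I) : Fin m → ZMod (2 ^ ℓ) :=
  starShare K (fun w => s.val w + s.maskLo w) s.maskHi s.fHi

/-- The share number 1 of `β*`, computed by `P_0`. -/
def OnSt.star₁P₀ (s : OnSt ℓ κ m I) : Fin m → ZMod (2 ^ ℓ) :=
  starShare K s.val s.maskHi s.fHi

/-- The share number 2 of `β*`, computed by `P_0`. -/
def OnSt.star₂P₀ (s : OnSt ℓ κ m I) : Fin m → ZMod (2 ^ ℓ) :=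
  starShare K s.val s.maskLo s.fLo

/-- The state of `P_1` or `P_2` after the layer `t`, whose shares of `β*` are `a, a'`; for the other
gates nothing changes. `γ` are the masks and `φ` the share number 2 of the preprocessed dot products, so
that `ψ = φ - ∑ γγ` and `β = β* + ∑ ββ + ψ`. -/
def OnSt.absorb (s : OnSt ℓ κ m I) (t : Fin T) (a a' : Fin m → ZMod (2 ^ ℓ))
    (γ : Fin I ⊕ Fin m → ZMod (2 ^ ℓ)) (φ : Fin m → ZMod (2 ^ ℓ)) : OnSt ℓ κ m I :=
  { s with
    star₁ := fun g => if K.layer g = t then a g else s.star₁ g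
    star₂ := fun g => if K.layer g = t then a' g else s.star₂ g
    val := Sum.elim (fun x => s.val (.inl x)) fun g =>
      if K.layer g = t then
        (a g + a' g) + (∑ j : Fin n, s.val (K.left g j) * s.val (K.right g j)) +
          (φ g - ∑ j : Fin n, γ (K.left g j) * γ (K.right g j))
      else s.val (.inr g) }

/-- Values received for the gates of a layer. -/
def ofLayer (t : Fin T) (v : Option ({g : Fin m // K.layer g = t} → ZMod (2 ^ ℓ))) (g : Fin m) :
    ZMod (2 ^ ℓ) :=
  if h : K.layer g = t then (v.getD 0) ⟨g, h⟩ else 0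

/-- The round of a layer: `P_1` and `P_2` exchange the shares of `β*` for its gates (the send phase of
joint message passing of share 1 to `P_2` and of share 2 to `P_1`) and compute `β`. -/
def layerRound (t : Fin T) : Round (OnSt ℓ κ m I) where
  Priv _ _ := {g : Fin m // K.layer g = t} → ZMod (2 ^ ℓ)
  Bc _ := Empty
  send p q s :=
    if p = 1 ∧ q = 2 then some fun g => s.star₁P₁ K g
    else if p = 2 ∧ q = 1 then some fun g => s.star₂P₂ K g
    else none
  bcast _ _ := none
  recv p s inb _ :=
    if p = 1 then
      { s.absorb K t (s.star₁P₁ K) (ofLayer K t (inb 2)) s.maskHi s.fHi with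
        missing := s.missing || (inb 2).isNone }
    else if p = 2 then
      { s.absorb K t (ofLayer K t (inb 1)) (s.star₂P₂ K) s.maskLo s.fLo with
        missing := s.missing || (inb 1).isNone }
    else s

/-- The deferred send phase of joint message passing of all `β + γ` to `P_0`. -/
def deliverRound : Round (OnSt ℓ κ m I) where
  Priv _ _ := Fin m → ZMod (2 ^ ℓ)
  Bc _ := Empty
  send p q s := if p = 1 ∧ q = 0 then some fun g => s.val (.inr g) + s.maskHi (.inr g) else none
  bcast _ _ := none
  recv p s inb _ :=
    if p = 0 then
      { s with
        val := Sum.elim (fun x => s.val (.inl x)) ((inb 1).getD 0)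
        missing := (inb 1).isNone }
    else s

/-- The values `β + γ` that `P_1, P_2` pass jointly to `P_0`. -/
def toP₀ (p : Srv) (s : OnSt ℓ κ m I) : Option (Fin m → ZMod (2 ^ ℓ)) :=
  if p = 1 then some fun g => s.val (.inr g) + s.maskHi (.inr g)
  else if p = 2 then some fun g => s.val (.inr g) + s.maskLo (.inr g)
  else if s.missing then none else some fun g => s.val (.inr g)

/-- The shares number 1 of `β*` that `P_1, P_0` pass jointly to `P_2`. -/
def toP₂ (p : Srv) (s : OnSt ℓ κ m I) : Option (Fin m → ZMod (2 ^ ℓ)) :=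
  if p = 1 then some s.star₁
  else if p = 0 then some (s.star₁P₀ K)
  else if s.missing then none else some s.star₁

/-- The shares number 2 of `β*` that `P_2, P_0` pass jointly to `P_1`. -/
def toP₁ (p : Srv) (s : OnSt ℓ κ m I) : Option (Fin m → ZMod (2 ^ ℓ)) :=
  if p = 2 then some s.star₂
  else if p = 0 then some (s.star₂P₀ K)
  else if s.missing then none else some s.star₂

/-- The online phase for all gates: one round for each layer, the deferred values for `P_0`, and one
verify phase of joint message passing for each receiver, on all values together. -/
def online (hash : (Fin m → ZMod (2 ^ ℓ)) → Dig κ) : List (Round (OnSt ℓ κ m I)) :=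
  (List.finRange T).map (layerRound K) ++ [deliverRound] ++
    jmpVerify 1 2 0 hash toP₀ OnSt.jmp (fun s J => { s with jmp := J }) ++
    jmpVerify 1 0 2 hash (toP₂ K) OnSt.jmp (fun s J => { s with jmp := J }) ++
    jmpVerify 2 0 1 hash (toP₁ K) OnSt.jmp (fun s J => { s with jmp := J })

end

/-- The state in which `P_p` enters the online phase: the masks of all wires, the values of the shared
inputs, and the output of the preprocessing. -/
def onInit {P : Par} {I : ℕ} (mask : Srv → Fin I ⊕ Fin P.m → P.Z) (β : Fin I → P.Z)
    (σ : Srv → PreSt P) (p : Srv) : OnSt P.ℓ P.κ P.m I where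
  maskLo := mask p
  maskHi := mask (p + 1)
  fLo := (σ p).fLo
  fHi := (σ p).fHi
  val := Sum.elim (fun x => if p = 0 then β x + mask 2 (.inl x) else β x) 0
  star₁ := 0
  star₂ := 0
  missing := false
  jmp := Jmp.start P.κ

/-- The states `σ` hold sharings of the values `v` with the masks `mask`: `P_1, P_2` hold
`β = v + α` and `P_0` holds `β + γ`, next to the masks known to them. -/
def Shared {ℓ κ m I : ℕ} (mask : Srv → Fin I ⊕ Fin m → ZMod (2 ^ ℓ))
    (σ : Srv → OnSt ℓ κ m I) (v : Fin I ⊕ Fin m → ZMod (2 ^ ℓ)) : Prop :=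
  (∀ p, (σ p).maskLo = mask p ∧ (σ p).maskHi = mask (p + 1)) ∧
  ∀ w, (σ 1).val w = v w + (mask 0 w + mask 1 w) ∧ (σ 2).val w = v w + (mask 0 w + mask 1 w) ∧
    (σ 0).val w = v w + (mask 0 w + mask 1 w) + mask 2 w

end

end DotP3

open DotP3

/-! Soundness rests on the structure of the extended ring `E`. It is a finite local ring with
residue field `K` of size `2^d` and maximal ideal `(2)`, whose socle is generated by the last
non-zero power of `2`. A non-zero family in `E` can be multiplied into that socle, where only
residues matter. Hence a linear form with a non-zero coefficient vanishes with probability at most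
`2^(-d)` (`IsResidue.card_linear_le`), and a non-zero polynomial of degree at most `D` has at most
`D` times the size of the maximal ideal many roots (`IsResidue.card_roots_le`).

The verifiers' messages are linear in their shares, so acceptance depends only on the reconstructed
polynomial `p` and on the true proof polynomial `q` of the inputs (`accept_vMsg_iff`). If `p = q`,
then `p` takes a non-zero value at the point of a bad group and the random combination with `η`
detects it. If `p ≠ q`, then `r` must be a root of `p - q`. The coins `θ` hide a wrong message with
probability at most `2^(-d)`, because the output of its group is a linear form in `θ`.

The honest executions are computed symbolically: every round carries an explicit state to the next
explicit state. A verify phase finds no inconsistency because all three servers hold the same value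
(`jmpVerify_run`). Correctness comes down to two identities: the nine products of shares of a dot
product are distributed among the servers (`sum_share`), and the masks cancel in a gate
(`masked_gate`). Malicious cost bounds hold round by round for arbitrary states (`CostLe`), since
only the channels used and the message types matter.

For the amortized cost, about `√m` groups of about `√m` dot products and an extension degree of
order `log m` make the verification cost `O(√m log m)`, which is `o(m)`, while the cheating
probability stays below the given bound. -/

namespace DotP3

/-! ### Counting zeros over a finite local ring with maximal ideal `(2)` -/

section
variable {E K : Type} [CommRing E] [Field K] {red : E →+* K} {e : ℕ}

/-- The properties of a surjection onto the residue field with kernel `(2)`, where `2 ^ e` is the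
last non-zero power of `2`. -/
structure IsResidue (red : E →+* K) (e : ℕ) : Prop where
  surj : Function.Surjective red
  ker : ∀ y, red y = 0 → ∃ z, y = 2 * z
  two : red 2 = 0
  ne : (2 : E) ^ e ≠ 0
  nil : (2 : E) ^ (e + 1) = 0

/-- Lifting the inverse of the residue gives `y * z = 1 + 2 * w`, and `2 * w` is nilpotent. -/
theorem IsResidue.isUnit (h : IsResidue red e) {y : E} (hy : red y ≠ 0) : IsUnit y := by
  obtain ⟨z, hz⟩ := h.surj (red y)⁻¹
  obtain ⟨w, hw⟩ := h.ker (y * z - 1) (by simp [hz, hy])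
  have hn : IsNilpotent (2 * w) := ⟨e + 1, by rw [mul_pow, h.nil, zero_mul]⟩
  have := hn.isUnit_one_add
  rw [← hw, add_sub_cancel] at this
  exact isUnit_of_mul_isUnit_left this

theorem IsResidue.pow_mul_eq_zero (h : IsResidue red e) {y : E} : 2 ^ e * y = 0 ↔ red y = 0 := by
  constructor
  · intro h0
    by_contra hy
    exact h.ne ((h.isUnit hy).mul_left_eq_zero.1 h0)
  · intro h0
    obtain ⟨z, rfl⟩ := h.ker y h0
    rw [← mul_assoc, ← pow_succ, h.nil, zero_mul]

/-- Factors `2` can be split off one at a time: if `y = 2 ^ j * z` with `j < e` and `z` were a unit,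
then `2 * y = 0` would force `2 ^ (j + 1) = 0`, so `z` lies in the maximal ideal `(2)`. -/
theorem IsResidue.exists_pow_mul (h : IsResidue red e) {y : E} (hy : 2 * y = 0) :
    ∃ z, y = 2 ^ e * z := by
  suffices H : ∀ j ≤ e, ∃ z, y = 2 ^ j * z from H e le_rfl
  intro j
  induction j with
  | zero => exact fun _ => ⟨y, by simp⟩
  | succ j ih =>
    intro hj
    obtain ⟨z, rfl⟩ := ih (by omega)
    have hz : red z = 0 := by
      by_contra hz
      rw [← mul_assoc, ← pow_succ', (h.isUnit hz).mul_left_eq_zero] at hy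
      refine h.ne ?_
      rw [← Nat.sub_add_cancel hj, pow_add, hy, mul_zero]
    obtain ⟨w, rfl⟩ := h.ker z hz
    exact ⟨w, by ring⟩

/-- A non-zero family becomes, after multiplication by a constant, the multiple by the socle
generator `2 ^ e` of a family that is non-zero in the residue field. -/
theorem IsResidue.exists_family (h : IsResidue red e) {ι : Type} {x : ι → E} {i₀ : ι}
    (hx : x i₀ ≠ 0) :
    ∃ c : E, ∃ y : ι → E, (∀ i, c * x i = 2 ^ e * y i) ∧ ∃ i, red (y i) ≠ 0 := by
  classical
  -- The multiplier is the last power of `2` that does not kill the whole family, one below the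
  -- least power that does. Its multiples of the `x i` are killed by `2`, so they are multiples of
  -- `2 ^ e`.
  have hex : ∃ j, ∀ i, 2 ^ j * x i = 0 := ⟨e + 1, fun i => by rw [h.nil, zero_mul]⟩
  have h0 : Nat.find hex ≠ 0 := fun h0 => hx (by
    simpa [h0] using Nat.find_spec hex i₀)
  obtain ⟨j, hj⟩ := Nat.exists_eq_succ_of_ne_zero h0
  have hs := Nat.find_spec hex
  have hm := Nat.find_min hex (m := j) (by omega)
  rw [hj] at hs
  push Not at hm
  obtain ⟨i, hi⟩ := hm
  choose y hy using fun i => h.exists_pow_mul (y := 2 ^ j * x i) (by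
    rw [← mul_assoc, ← pow_succ']; exact hs i)
  refine ⟨2 ^ j, y, hy, i, fun h1 => hi ?_⟩
  rw [hy, h.pow_mul_eq_zero.2 h1]

/-- After multiplication by `c` the coefficients lie in the socle, so a zero of the linear form over
`E` reduces to a zero of a non-zero linear form over `K`. The latter form is a surjection onto `K`,
whose kernel has index `|K|`. -/
theorem IsResidue.card_linear_le (h : IsResidue red e) [Finite E] {ι : Type} [Fintype ι]
    {v : ι → E} {i₀ : ι} (hv : v i₀ ≠ 0) :
    Nat.card {η : ι → E | ∑ i, η i * v i = 0} * Nat.card K ≤ Nat.card (ι → E) := by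
  classical
  obtain ⟨c, y, hy, i, hi⟩ := h.exists_family hv
  let φ : (ι → E) →+ K :=
    { toFun := fun η => ∑ i, red (η i) * red (y i)
      map_zero' := by simp
      map_add' := fun a b => by simp [add_mul, Finset.sum_add_distrib] }
  have hφ : Function.Surjective φ := by
    intro t
    obtain ⟨s, hs⟩ := h.surj (t / red (y i))
    refine ⟨Pi.single i s, ?_⟩
    change ∑ k, red ((Pi.single i s : ι → E) k) * red (y k) = t
    rw [Finset.sum_eq_single i]
    · simp [hs, hi]
    · intro b _ hb
      simp [hb]
    · simp
  have hc : Nat.card φ.ker * Nat.card K = Nat.card (ι → E) := by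
    rw [← φ.ker.card_mul_index, AddSubgroup.index_ker, AddMonoidHom.range_eq_top.2 hφ,
      AddSubgroup.card_top]
  rw [← hc]
  refine Nat.mul_le_mul_right _ (Nat.card_mono (Set.toFinite (φ.ker : Set (ι → E))) ?_)
  intro η hη
  change ∑ i, red (η i) * red (y i) = 0
  simp_rw [← map_mul, ← map_sum]
  rw [← h.pow_mul_eq_zero, Finset.mul_sum]
  have : c * ∑ i, η i * v i = 0 := by rw [hη, mul_zero]
  rw [← this, Finset.mul_sum]
  exact Finset.sum_congr rfl fun k _ => by linear_combination (-η k) * hy k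

theorem card_fiber_eq [Finite E] (hs : Function.Surjective red) (t : K) :
    Nat.card {x : E // red x = t} = Nat.card {x : E // red x = 0} := by
  obtain ⟨a, rfl⟩ := hs t
  exact Nat.card_congr
    { toFun := fun x => ⟨x - a, by simp [x.2]⟩
      invFun := fun x => ⟨x + a, by simp [x.2]⟩
      left_inv := fun x => by simp
      right_inv := fun x => by simp }

theorem card_eq_mul_card_fiber [Finite E] (hs : Function.Surjective red) :
    Nat.card E = Nat.card K * Nat.card {x : E // red x = 0} := by
  have := Finite.of_surjective red hs
  have := Fintype.ofFinite K
  rw [← Nat.card_congr (Equiv.sigmaFiberEquiv red), Nat.card_sigma]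
  simp [card_fiber_eq hs]

/-- Some multiple of `p` is `2 ^ e` times a polynomial with non-zero reduction `q`. Every root of
`p` reduces to one of the at most `D` roots of `q` in the field `K`, and all fibres of the reduction
have the size of its kernel. Over `E` itself the bound `D` would be false. -/
theorem IsResidue.card_roots_le (h : IsResidue red e) [Finite E] {p : E[X]} (hp : p ≠ 0) {D : ℕ}
    (hD : p.natDegree ≤ D) :
    Nat.card {x : E | p.eval x = 0} ≤ D * Nat.card {x : E // red x = 0} := by
  classical
  have := Finite.of_surjective red h.surj
  obtain ⟨i₀, hi₀⟩ : ∃ i, p.coeff i ≠ 0 := by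
    by_contra! hc
    exact hp (Polynomial.ext (by simpa using hc))
  have hi₀D : i₀ ≤ D := (le_natDegree_of_ne_zero hi₀).trans hD
  obtain ⟨c, y, hy, i, hi⟩ := h.exists_family (x := fun i : Fin (D + 1) => p.coeff i)
    (i₀ := ⟨i₀, by omega⟩) hi₀
  set q : K[X] := ∑ i : Fin (D + 1), C (red (y i)) * X ^ (i : ℕ) with hq
  have hqc : q.coeff i = red (y i) := by
    rw [hq, finsetSum_coeff, Finset.sum_eq_single i]
    · simp
    · intro b _ hb
      rw [coeff_C_mul_X_pow, if_neg]
      exact fun h => hb (Fin.ext h.symm)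
    · simp
  have hq0 : q ≠ 0 := fun h0 => hi (by rw [← hqc, h0, coeff_zero])
  have hqD : q.natDegree ≤ D := natDegree_sum_le_of_forall_le _ _ fun i _ =>
    (natDegree_C_mul_X_pow_le _ _).trans (by omega)
  have hroot : ∀ x : E, p.eval x = 0 → red x ∈ q.roots.toFinset := by
    intro x hx
    rw [Multiset.mem_toFinset, mem_roots hq0, IsRoot, hq, eval_finsetSum]
    simp only [eval_mul, eval_C, eval_pow, eval_X]
    simp_rw [← map_pow, ← map_mul, ← map_sum]
    rw [← h.pow_mul_eq_zero, Finset.mul_sum]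
    have hev : p.eval x = ∑ i : Fin (D + 1), p.coeff i * x ^ (i : ℕ) := by
      rw [Fin.sum_univ_eq_sum_range (fun i => p.coeff i * x ^ i)]
      exact eval_eq_sum_range' (by omega) x
    rw [← mul_zero c, ← hx, hev, Finset.mul_sum]
    exact Finset.sum_congr rfl fun k _ => by linear_combination (-x ^ (k : ℕ)) * hy k
  have hle : Nat.card {x : E | p.eval x = 0} ≤
      Nat.card (Σ t : q.roots.toFinset, {x : E // red x = t}) := by
    refine Nat.card_le_card_of_injective
      (fun x => ⟨⟨red x.1, hroot x.1 x.2⟩, ⟨x.1, rfl⟩⟩) ?_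
    intro a b hab
    simp only [Sigma.mk.injEq, Subtype.mk.injEq] at hab
    obtain ⟨h1, h2⟩ := hab
    apply Subtype.ext
    have := (Subtype.heq_iff_coe_eq (by intro z; rw [h1])).1 h2
    exact this
  refine hle.trans ?_
  rw [Nat.card_sigma]
  simp only [card_fiber_eq h.surj, Finset.sum_const, Finset.card_univ, Fintype.card_coe,
    smul_eq_mul]
  refine Nat.mul_le_mul_right _ ((Multiset.toFinset_card_le _).trans ((card_roots' q).trans hqD))

end

/-! ### The extended ring: residue field, cardinality and evaluation points -/

section
variable {P : Par}

/-- Reduction of the extended ring modulo `2`. -/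
noncomputable def residue (P : Par) (hP : P.Valid) :
    P.E →+* AdjoinRoot (P.f.map (Int.castRingHom (ZMod 2))) :=
  AdjoinRoot.map (ZMod.castHom (dvd_pow_self 2 (Nat.one_le_iff_ne_zero.1 hP.ring)) (ZMod 2)) _ _
    (by
      rw [Polynomial.map_map]
      exact dvd_of_eq (congrArg P.f.map (RingHom.ext_int _ _)))

namespace Par.Valid

variable (hP : P.Valid)
include hP

theorem one_le_d : 1 ≤ P.d := by
  have h := hP.irred.natDegree_pos
  rwa [hP.monic.natDegree_map] at h

theorem nontrivial_Z : Nontrivial P.Z :=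
  ZMod.nontrivial_iff.2 (Nat.one_lt_two_pow (Nat.one_le_iff_ne_zero.1 hP.ring)).ne'

theorem natDegree_map : (P.f.map (Int.castRingHom P.Z)).natDegree = P.d := by
  have := hP.nontrivial_Z
  exact hP.monic.natDegree_map _

theorem card_E : Nat.card P.E = 2 ^ (P.ℓ * P.d) := by
  have := hP.nontrivial_Z
  let b := (AdjoinRoot.powerBasis' (hP.monic.map (Int.castRingHom P.Z))).basis
  rw [Nat.card_congr b.equivFun.toEquiv, Nat.card_fun]
  rw [Nat.card_zmod, Nat.card_fin, AdjoinRoot.powerBasis'_dim, hP.natDegree_map, pow_mul]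

theorem finite_E : Finite P.E := Nat.finite_of_card_ne_zero (by rw [hP.card_E]; positivity)

theorem card_residue :
    Nat.card (AdjoinRoot (P.f.map (Int.castRingHom (ZMod 2)))) = 2 ^ P.d := by
  let b := (AdjoinRoot.powerBasis' (hP.monic.map (Int.castRingHom (ZMod 2)))).basis
  rw [Nat.card_congr b.equivFun.toEquiv, Nat.card_fun]
  rw [Nat.card_zmod, Nat.card_fin, AdjoinRoot.powerBasis'_dim, hP.monic.natDegree_map]

/-- A monic polynomial of positive degree divides no non-zero constant, even over a ring with zero
divisors. -/
theorem of_injective : Function.Injective (AdjoinRoot.of (P.f.map (Int.castRingHom P.Z))) := by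
  have := hP.nontrivial_Z
  have hm := hP.monic.map (Int.castRingHom P.Z)
  rw [injective_iff_map_eq_zero]
  intro a ha
  rw [← AdjoinRoot.mk_C, AdjoinRoot.mk_eq_zero] at ha
  by_contra h0
  refine hm.not_dvd_of_natDegree_lt (C_ne_zero.2 h0) ?_ ha
  rw [natDegree_C, hP.natDegree_map]
  exact hP.one_le_d

theorem two_pow_Z_ne : (2 : P.Z) ^ (P.ℓ - 1) ≠ 0 := by
  have := (ZMod.natCast_eq_zero_iff (2 ^ (P.ℓ - 1)) (2 ^ P.ℓ)).not.2 fun h => by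
    have := (Nat.pow_dvd_pow_iff_le_right (x := 2) (by norm_num)).1 h
    have := hP.ring
    omega
  simpa using this

omit hP in
theorem two_pow_Z : (2 : P.Z) ^ P.ℓ = 0 := by
  rw [← ZMod.natCast_self (2 ^ P.ℓ), Nat.cast_pow, Nat.cast_ofNat]

theorem residue_mk (p : P.Z[X]) : residue P hP (AdjoinRoot.mk _ p) =
    AdjoinRoot.mk _ (p.map (ZMod.castHom
      (dvd_pow_self 2 (Nat.one_le_iff_ne_zero.1 hP.ring)) (ZMod 2))) := by
  rw [residue, AdjoinRoot.map, AdjoinRoot.lift_mk, ← eval₂_map, ← AdjoinRoot.algebraMap_eq,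
    ← aeval_def, AdjoinRoot.aeval_eq]

theorem isResidue [Fact (Irreducible (P.f.map (Int.castRingHom (ZMod 2))))] :
    IsResidue (residue P hP) (P.ℓ - 1) where
  surj := by
    intro y
    obtain ⟨q, rfl⟩ := AdjoinRoot.mk_surjective y
    obtain ⟨p, rfl⟩ := Polynomial.map_surjective _ (ZMod.castHom_surjective
      (dvd_pow_self 2 (Nat.one_le_iff_ne_zero.1 hP.ring))) q
    exact ⟨AdjoinRoot.mk _ p, hP.residue_mk p⟩
  ker := by
    intro y hy
    obtain ⟨q, rfl⟩ := AdjoinRoot.mk_surjective y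
    rw [hP.residue_mk, AdjoinRoot.mk_eq_zero] at hy
    set c := ZMod.castHom (dvd_pow_self 2 (Nat.one_le_iff_ne_zero.1 hP.ring)) (ZMod 2) with hc
    obtain ⟨h', hh⟩ := hy
    obtain ⟨h, rfl⟩ := Polynomial.map_surjective c (ZMod.castHom_surjective _) h'
    have hf : P.f.map (Int.castRingHom (ZMod 2)) = (P.f.map (Int.castRingHom P.Z)).map c := by
      rw [Polynomial.map_map]
      exact congrArg P.f.map (RingHom.ext_int _ _)
    rw [hf, ← Polynomial.map_mul, ← sub_eq_zero, ← Polynomial.map_sub] at hh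
    -- Lifting the quotient modulo `2` changes `q` by a multiple of `f` into a polynomial whose
    -- coefficients are all even.
    set r := q - P.f.map (Int.castRingHom P.Z) * h with hr
    have hdvd : C (2 : P.Z) ∣ r := by
      rw [C_dvd_iff_dvd_coeff]
      intro i
      have hi : c (r.coeff i) = 0 := by rw [← coeff_map, hh, coeff_zero]
      obtain ⟨a, ha⟩ := ZMod.natCast_zmod_surjective (n := 2 ^ P.ℓ) (r.coeff i)
      rw [← ha, map_natCast, ZMod.natCast_eq_zero_iff] at hi
      obtain ⟨b, rfl⟩ := hi
      exact ⟨b, by rw [← ha]; push_cast; rfl⟩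
    obtain ⟨s, hs⟩ := hdvd
    refine ⟨AdjoinRoot.mk _ s, ?_⟩
    have : q = C 2 * s + P.f.map (Int.castRingHom P.Z) * h := by rw [← hs, hr]; ring
    rw [this]
    simp [map_ofNat]
  two := by
    have h2 : (2 : ZMod 2) = 0 := by decide
    have := map_ofNat (AdjoinRoot.of (P.f.map (Int.castRingHom (ZMod 2)))) 2
    rw [map_ofNat, ← this]
    change AdjoinRoot.of _ (2 : ZMod 2) = 0
    rw [h2, map_zero]
  ne := by
    rw [← map_ofNat (AdjoinRoot.of (P.f.map (Int.castRingHom P.Z))) 2, ← map_pow]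
    exact (map_ne_zero_iff _ hP.of_injective).2 hP.two_pow_Z_ne
  nil := by
    rw [Nat.sub_add_cancel hP.ring, ← map_ofNat (AdjoinRoot.of (P.f.map (Int.castRingHom P.Z))) 2,
      ← map_pow]
    have := two_pow_Z (P := P)
    erw [this, map_zero]

/-- Numbers up to `M < 2 ^ d` are determined by their first `d` binary digits. So the reductions of
two points come from different polynomials of degree below `d` over `ZMod 2`, and `f` cannot divide
their difference. A non-zero residue makes the difference a unit. -/
theorem isUnit_pt_sub {a b : ℕ} (ha : a ≤ P.M) (hb : b ≤ P.M) (hab : a ≠ b) :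
    IsUnit (pt P a - pt P b) := by
  have : Fact (Irreducible (P.f.map (Int.castRingHom (ZMod 2)))) := ⟨hP.irred⟩
  refine hP.isResidue.isUnit ?_
  have hpt : ∀ a, residue P hP (pt P a) = AdjoinRoot.mk _ (∑ b ∈ Finset.range P.d,
      if a.testBit b then X ^ b else 0) := by
    intro a
    simp only [pt, map_sum]
    refine Finset.sum_congr rfl fun b _ => ?_
    split_ifs
    · simp [residue]
    · simp
  rw [map_sub, hpt, hpt, ← map_sub, Ne, AdjoinRoot.mk_eq_zero]
  have hcoef : ∀ a i : ℕ, i < P.d → (∑ b ∈ Finset.range P.d,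
      if a.testBit b then (X : (ZMod 2)[X]) ^ b else 0).coeff i = if a.testBit i then 1 else 0 := by
    intro a i hi
    rw [finsetSum_coeff, Finset.sum_eq_single i]
    · split_ifs <;> simp
    · intro b _ hbi
      split_ifs
      · rw [coeff_X_pow, if_neg (Ne.symm hbi)]
      · simp
    · simp [hi]
  have hdeg : ∀ a : ℕ, (∑ b ∈ Finset.range P.d,
      if a.testBit b then (X : (ZMod 2)[X]) ^ b else 0).natDegree < P.d := by
    intro a
    refine (natDegree_sum_le_of_forall_le (n := P.d - 1) _ _ ?_).trans_lt
      (by have := hP.one_le_d; omega)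
    intro b hb
    rw [Finset.mem_range] at hb
    split_ifs
    · rw [natDegree_X_pow]; omega
    · simp
  refine (hP.monic.map _).not_dvd_of_natDegree_lt ?_ ?_
  · intro h0
    apply hab
    refine Nat.eq_of_testBit_eq fun i => ?_
    rcases lt_or_ge i P.d with hi | hi
    · have h1 := congrArg (fun p => coeff p i) (sub_eq_zero.1 h0)
      simp only [hcoef _ _ hi] at h1
      cases h2 : a.testBit i <;> cases h3 : b.testBit i <;> simp_all
    · have := hP.points
      have hpow : 2 ^ P.d ≤ 2 ^ i := Nat.pow_le_pow_right (by norm_num) hi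
      rw [Nat.testBit_lt_two_pow (by omega), Nat.testBit_lt_two_pow (by omega)]
  · rw [hP.monic.natDegree_map]
    exact (natDegree_sub_le _ _).trans_lt (max_lt (hdeg a) (hdeg b))

theorem eval_lagr {a b : ℕ} (ha : a ≤ P.M) (hb : b ≤ P.M) :
    (lagr P a).eval (pt P b) = if a = b then 1 else 0 := by
  rw [lagr, eval_prod]
  split_ifs with h
  · subst h
    refine Finset.prod_eq_one fun c hc => ?_
    rw [Finset.mem_erase, Finset.mem_range] at hc
    simp only [eval_mul, eval_C, eval_sub, eval_X]
    exact Ring.inverse_mul_cancel _ (hP.isUnit_pt_sub ha (by omega) hc.1.symm)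
  · refine Finset.prod_eq_zero (i := b) ?_ ?_
    · rw [Finset.mem_erase, Finset.mem_range]
      exact ⟨Ne.symm h, by omega⟩
    · simp

omit hP in
theorem natDegree_lagr_le {a : ℕ} (ha : a ≤ P.M) : (lagr P a).natDegree ≤ P.M := by
  refine (natDegree_prod_le _ _).trans ((Finset.sum_le_card_nsmul _ _ 1 fun b _ => ?_).trans ?_)
  · exact (natDegree_C_mul_le _ _).trans (natDegree_X_sub_C_le _)
  · rw [Finset.card_erase_of_mem (by simp; omega)]
    simp

end Par.Valid
end

/-! ### Uniform probability on products -/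

section
variable {Ω Ω' : Type}

theorem prob_mono [Finite Ω] {A B : Set Ω} (h : A ⊆ B) : prob A ≤ prob B := by
  unfold prob
  gcongr
  exact Nat.card_mono (Set.toFinite B) h

theorem prob_le_one [Finite Ω] (A : Set Ω) : prob A ≤ 1 := by
  refine div_le_one_of_le₀ ?_ (Nat.cast_nonneg _)
  exact_mod_cast Finite.card_subtype_le _

theorem prob_nonneg (A : Set Ω) : 0 ≤ prob A := by unfold prob; positivity

theorem prob_prod [Fintype Ω] (Q : Ω → Set Ω') [Finite Ω'] :
    prob {ω : Ω × Ω' | ω.2 ∈ Q ω.1} = (∑ a, prob (Q a)) / Nat.card Ω := by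
  have : Nat.card {ω : Ω × Ω' | ω.2 ∈ Q ω.1} = ∑ a, Nat.card (Q a) := by
    rw [← Nat.card_sigma]
    exact Nat.card_congr
      { toFun := fun ω => ⟨ω.1.1, ω.1.2, ω.2⟩
        invFun := fun z => ⟨(z.1, z.2.1), z.2.2⟩
        left_inv := fun _ => rfl
        right_inv := fun _ => rfl }
  unfold prob
  rw [this, Nat.card_prod, ← Finset.sum_div, div_div, mul_comm (Nat.card Ω' : ℝ)]
  push_cast
  rfl

/-- If an event has probability at most `ε` outside of a bad set for the first component, then its
probability exceeds that of the bad set by at most `ε`. -/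
theorem prob_prod_le [Finite Ω] [Nonempty Ω] [Finite Ω'] (Q : Ω → Set Ω') (B : Set Ω) {ε : ℝ}
    (hε : 0 ≤ ε) (h : ∀ a, a ∉ B → prob (Q a) ≤ ε) :
    prob {ω : Ω × Ω' | ω.2 ∈ Q ω.1} ≤ prob B + ε := by
  classical
  have := Fintype.ofFinite Ω
  have hc : (0 : ℝ) < Nat.card Ω := by exact_mod_cast Nat.card_pos
  rw [prob_prod, div_le_iff₀ hc, add_mul, prob, div_mul_cancel₀ _ hc.ne']
  calc ∑ a, prob (Q a) ≤ ∑ a, ((if a ∈ B then 1 else 0) + ε) := by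
        refine Finset.sum_le_sum fun a _ => ?_
        split_ifs with ha
        · linarith [prob_le_one (Q a)]
        · linarith [h a ha]
    _ = _ := by
        rw [Finset.sum_add_distrib, Finset.sum_const, Finset.sum_boole]
        simp [mul_comm, Fintype.card_subtype]

theorem prob_fst_le [Finite Ω] [Nonempty Ω] [Finite Ω'] (B : Set Ω) :
    prob {ω : Ω × Ω' | ω.1 ∈ B} ≤ prob B := by
  have h := prob_prod_le (fun a : Ω => {_b : Ω' | a ∈ B}) B le_rfl fun a ha => by
    simp [prob, ha]
  simpa using h

theorem prob_snd_le [Finite Ω] [Nonempty Ω] [Finite Ω'] (B : Set Ω') :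
    prob {ω : Ω × Ω' | ω.2 ∈ B} ≤ prob B := by
  have h := prob_prod_le (fun _ : Ω => B) ∅ (prob_nonneg B) fun a _ => le_rfl
  simpa [prob] using h

theorem prob_le_of_card {A : Set Ω} {ε : ℝ} (hε : 0 ≤ ε)
    (h : (Nat.card A : ℝ) ≤ ε * Nat.card Ω) : prob A ≤ ε :=
  div_le_of_le_mul₀ (Nat.cast_nonneg _) hε h

end

/-! ### Circuits, wire polynomials and the verifiers' decision -/

section
variable {R S : Type} [CommRing R] [CommRing S] {n L : ℕ}

theorem map_cCirc (φ : R →+* S) (x : Slot n → R) : φ (cCirc x) = cCirc fun s => φ (x s) := by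
  simp [cCirc]

theorem map_gCirc (φ : R →+* S) (θ : Fin L → R) (x : Fin L → Slot n → R) :
    φ (gCirc θ x) = gCirc (fun k => φ (θ k)) fun k s => φ (x k s) := by
  simp [gCirc, map_cCirc]

theorem cCirc_zero : cCirc (fun _ : Slot n => (0 : R)) = 0 := by simp [cCirc]

end

section
variable {P : Par}

theorem grouped_add (x x' : Fin P.m → Slot P.n → P.Z) (a : Fin P.M) (k : Fin P.L) (s : Slot P.n) :
    grouped P x a k s + grouped P x' a k s = grouped P (fun k s => x k s + x' k s) a k s := by
  unfold grouped
  split_ifs <;> simp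

theorem wirePoly_add (b b' : Fin P.L → Slot P.n → P.E) (x x' : Fin P.m → Slot P.n → P.Z)
    (k : Fin P.L) (s : Slot P.n) : wirePoly P b x k s + wirePoly P b' x' k s =
      wirePoly P (fun k s => b k s + b' k s) (fun k s => x k s + x' k s) k s := by
  simp only [wirePoly, ← grouped_add, C_add, add_mul, Finset.sum_add_distrib]
  ring

/-- The polynomial with the given coefficients. -/
noncomputable def ofCoeffs {E : Type} [CommRing E] {N : ℕ} (c : Fin N → E) : E[X] :=
  ∑ t : Fin N, C (c t) * X ^ (t : ℕ)

theorem ofCoeffs_add {E : Type} [CommRing E] {N : ℕ} (c c' : Fin N → E) :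
    ofCoeffs c + ofCoeffs c' = ofCoeffs (fun t => c t + c' t) := by
  simp [ofCoeffs, add_mul, Finset.sum_add_distrib]

theorem ofCoeffs_coeff {E : Type} [CommRing E] {N : ℕ} {p : E[X]} (hp : p.natDegree < N) :
    ofCoeffs (fun t : Fin N => p.coeff t) = p := by
  rw [ofCoeffs, Fin.sum_univ_eq_sum_range (fun i => C (p.coeff i) * X ^ i)]
  exact (as_sum_range_C_mul_X_pow' p hp).symm

theorem natDegree_ofCoeffs_le {E : Type} [CommRing E] {N : ℕ} (c : Fin (N + 1) → E) :
    (ofCoeffs c).natDegree ≤ N :=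
  natDegree_sum_le_of_forall_le _ _ fun i _ => (natDegree_C_mul_X_pow_le _ _).trans (by omega)

theorem eval_proofPoly (θ : Fin P.L → P.E) (b : Fin P.L → Slot P.n → P.E)
    (x : Fin P.m → Slot P.n → P.Z) (r : P.E) :
    (proofPoly P θ b x).eval r = gCirc θ fun k s => (wirePoly P b x k s).eval r := by
  rw [proofPoly, ← coe_evalRingHom, map_gCirc]
  simp

/-- All entries of a verifier's message are linear in its shares; only the final evaluation of `g`
is not, and it is applied to reconstructed values. This reduces both completeness and soundness to a
comparison of two polynomials. -/
theorem accept_vMsg_iff (θ : Fin P.L → P.E) (η : Fin P.M → P.E) (r : P.E)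
    (x x' : Fin P.m → Slot P.n → P.Z) (b b' : Fin P.L → Slot P.n → P.E)
    (c c' : Fin (2 * P.M + 1) → P.E) :
    accept P θ (vMsg P η r c b x) (vMsg P η r c' b' x') ↔
      ∑ a : Fin P.M, η a * (ofCoeffs fun t => c t + c' t).eval (pt P (a + 1)) = 0 ∧
      (ofCoeffs fun t => c t + c' t).eval r =
        (proofPoly P θ (fun k s => b k s + b' k s) fun k s => x k s + x' k s).eval r := by
  rw [eval_proofPoly, ← ofCoeffs_add]
  simp only [accept, vMsg, ← eval_add, wirePoly_add, ← mul_add, ofCoeffs, ← Finset.sum_add_distrib]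

theorem natDegree_wirePoly_le (b : Fin P.L → Slot P.n → P.E) (x : Fin P.m → Slot P.n → P.Z)
    (k : Fin P.L) (s : Slot P.n) : (wirePoly P b x k s).natDegree ≤ P.M := by
  refine (natDegree_add_le _ _).trans (max_le ?_ (natDegree_sum_le_of_forall_le _ _ fun a _ => ?_))
  · exact (natDegree_C_mul_le _ _).trans (Par.Valid.natDegree_lagr_le (Nat.zero_le _))
  · exact (natDegree_C_mul_le _ _).trans (Par.Valid.natDegree_lagr_le a.2)

/-- The circuit `g` is quadratic in its inputs and wire polynomials have degree at most `M`; hence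
`2 * M + 1` coefficients determine the proof. -/
theorem natDegree_proofPoly_le (θ : Fin P.L → P.E) (b : Fin P.L → Slot P.n → P.E)
    (x : Fin P.m → Slot P.n → P.Z) : (proofPoly P θ b x).natDegree ≤ 2 * P.M := by
  have hw := natDegree_wirePoly_le b x
  have hmul : ∀ k s t, (wirePoly P b x k s * wirePoly P b x k t).natDegree ≤ 2 * P.M :=
    fun k s t => natDegree_mul_le.trans (by have := hw k s; have := hw k t; omega)
  have hw' : ∀ k s, (wirePoly P b x k s).natDegree ≤ 2 * P.M := fun k s => (hw k s).trans (by omega)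
  unfold proofPoly gCirc cCirc
  refine natDegree_sum_le_of_forall_le _ _ fun k _ => (natDegree_C_mul_le _ _).trans ?_
  refine (natDegree_sub_le _ _).trans (max_le ((natDegree_add_le _ _).trans (max_le (hw' _ _) ?_))
    (hw' _ _))
  refine natDegree_sum_le_of_forall_le _ _ fun j _ => ?_
  exact (natDegree_add_le _ _).trans (max_le ((natDegree_add_le _ _).trans
    (max_le (hmul _ _ _) (hmul _ _ _))) (hmul _ _ _))

theorem cCirc_grouped (x : Fin P.m → Slot P.n → P.Z) (a : Fin P.M) (k : Fin P.L) :
    cCirc (grouped P x a k) = if h : a * P.L + k < P.m then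
      AdjoinRoot.of _ (cCirc (x ⟨a * P.L + k, h⟩)) else 0 := by
  unfold grouped
  split_ifs with h
  · simp only [map_cCirc]
  · simp only [cCirc_zero]

/-! ### Soundness of the proofs -/

namespace Par.Valid
variable (hP : P.Valid)
include hP

theorem eval_wirePoly_pt (b : Fin P.L → Slot P.n → P.E) (x : Fin P.m → Slot P.n → P.Z)
    (a : Fin P.M) (k : Fin P.L) (s : Slot P.n) :
    (wirePoly P b x k s).eval (pt P (a + 1)) = grouped P x a k s := by
  rw [wirePoly, eval_add, eval_mul, eval_C, hP.eval_lagr (Nat.zero_le _) a.2, eval_finsetSum,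
    Finset.sum_eq_single a]
  · rw [eval_mul, eval_C, hP.eval_lagr a.2 a.2]
    simp
  · intro c _ hc
    rw [eval_mul, hP.eval_lagr c.2 a.2, if_neg, mul_zero]
    exact fun h => hc (Fin.ext (by omega))
  · simp

theorem eval_proofPoly_pt (θ : Fin P.L → P.E) (b : Fin P.L → Slot P.n → P.E)
    (x : Fin P.m → Slot P.n → P.Z) (a : Fin P.M) :
    (proofPoly P θ b x).eval (pt P (a + 1)) = gCirc θ (grouped P x a) := by
  simp only [eval_proofPoly, hP.eval_wirePoly_pt]

theorem card_evalPt : Nat.card (EvalPt P) = 2 ^ (P.ℓ * P.d) - P.M := by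
  classical
  have := hP.finite_E
  have := Fintype.ofFinite P.E
  -- Equal points would have difference zero, a unit only in the zero ring. So exactly `M` elements
  -- are excluded.
  have hinj : Function.Injective fun a : Fin P.M => pt P (a + 1) := by
    intro a b hab
    by_contra hne
    have := hP.isUnit_pt_sub a.2 b.2 fun h => hne (Fin.ext (by omega))
    have h0 : pt P (a + 1) - pt P (b + 1) = 0 := sub_eq_zero.2 hab
    rw [h0, isUnit_zero_iff] at this
    have hE : Nat.card P.E ≠ 1 := by
      rw [hP.card_E]
      exact (Nat.one_lt_two_pow (Nat.mul_ne_zero (Nat.one_le_iff_ne_zero.1 hP.ring)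
        (Nat.one_le_iff_ne_zero.1 hP.one_le_d))).ne'
    have hs : Subsingleton P.E := subsingleton_of_zero_eq_one this
    exact hE Nat.card_unique
  rw [← hP.card_E, Nat.card_eq_fintype_card, Nat.card_eq_fintype_card, Fintype.card_subtype,
    show (Finset.univ.filter fun r : P.E => ∀ a : Fin P.M, r ≠ pt P (a + 1)) =
      (Finset.univ.image fun a : Fin P.M => pt P (a + 1))ᶜ from by
        ext r; simp [eq_comm], Finset.card_compl, Finset.card_image_of_injective _ hinj]
  simp

theorem M_lt : P.M < 2 ^ (P.ℓ * P.d) :=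
  hP.points.trans_le (Nat.pow_le_pow_right (by norm_num) (Nat.le_mul_of_pos_left _ hP.ring))

theorem errBound_denom_pos : (0 : ℝ) < 2 ^ (P.ℓ * P.d) - P.M := by
  rw [sub_pos]
  exact_mod_cast hP.M_lt

theorem errBound_mono {y z : ℝ} (h : y ≤ z) :
    errBound P.ℓ P.d P.M y ≤ errBound P.ℓ P.d P.M z := by
  have := hP.errBound_denom_pos
  unfold errBound
  gcongr

theorem errBound_nonneg : 0 ≤ errBound P.ℓ P.d P.M (2 * P.M) := by
  have := hP.errBound_denom_pos
  unfold errBound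
  positivity

theorem two_pow_mul_d : (2 : ℝ) ^ (P.ℓ * P.d) = 2 ^ ((P.ℓ - 1) * P.d) * 2 ^ P.d := by
  rw [← pow_add]
  congr 1
  obtain ⟨l, hl⟩ : ∃ l, P.ℓ = l + 1 := ⟨P.ℓ - 1, by have := hP.ring; omega⟩
  rw [hl]
  simp only [Nat.add_sub_cancel]
  ring

/-- The failure probability of the linear test is absorbed by that of the evaluation test, so the
case distinction for a cheating prover yields a single bound instead of a sum. -/
theorem inv_two_pow_le_errBound (hM : 1 ≤ P.M) :
    ((2 : ℝ) ^ P.d)⁻¹ ≤ errBound P.ℓ P.d P.M (2 * P.M) := by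
  have := hP.errBound_denom_pos
  have hd : (0 : ℝ) < 2 ^ P.d := by positivity
  have hM' : (1 : ℝ) ≤ P.M := by exact_mod_cast hM
  rw [errBound, inv_le_iff_one_le_mul₀ hd, div_mul_eq_mul_div, le_div_iff₀ this, one_mul]
  have h1 : (2 : ℝ) ^ (P.ℓ * P.d) ≤ 2 ^ (P.ℓ * P.d) * (2 * P.M) :=
    le_mul_of_one_le_right (by positivity) (by linarith)
  have h2 := hP.two_pow_mul_d
  nlinarith

theorem finite_evalPt : Finite (EvalPt P) := by
  have := hP.finite_E
  infer_instance

theorem nonempty_evalPt : Nonempty (EvalPt P) := by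
  have := hP.finite_evalPt
  refine Finite.card_pos_iff.1 ?_
  rw [hP.card_evalPt]
  have := hP.M_lt
  omega

theorem prob_linear_le {ι : Type} [Fintype ι] {v : ι → P.E} {i₀ : ι} (hv : v i₀ ≠ 0) :
    prob {η : ι → P.E | ∑ i, η i * v i = 0} ≤ ((2 : ℝ) ^ P.d)⁻¹ := by
  have : Fact (Irreducible (P.f.map (Int.castRingHom (ZMod 2)))) := ⟨hP.irred⟩
  have := hP.finite_E
  have h := hP.isResidue.card_linear_le hv
  rw [hP.card_residue] at h
  refine prob_le_of_card (by positivity) ?_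
  rw [inv_mul_eq_div, le_div_iff₀ (by positivity)]
  exact_mod_cast h

theorem card_roots_le {p : P.E[X]} (hp : p ≠ 0) {D : ℕ} (hD : p.natDegree ≤ D) :
    (Nat.card {x : P.E | p.eval x = 0} : ℝ) ≤ 2 ^ ((P.ℓ - 1) * P.d) * D := by
  have : Fact (Irreducible (P.f.map (Int.castRingHom (ZMod 2)))) := ⟨hP.irred⟩
  have := hP.finite_E
  have h := hP.isResidue.card_roots_le hp hD
  have hc := card_eq_mul_card_fiber hP.isResidue.surj
  rw [hP.card_E, hP.card_residue] at hc
  have hc' := congrArg (Nat.cast (R := ℝ)) hc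
  push_cast at hc'
  rw [hP.two_pow_mul_d, mul_comm] at hc'
  have h1 := mul_left_cancel₀ (by positivity) hc'
  rw [h1, mul_comm]
  exact_mod_cast h

theorem prob_roots_le {p : P.E[X]} (hp : p ≠ 0) (hD : p.natDegree ≤ 2 * P.M) :
    prob {r : EvalPt P | p.eval r.1 = 0} ≤ errBound P.ℓ P.d P.M (2 * P.M) := by
  have := hP.finite_E
  refine prob_le_of_card hP.errBound_nonneg ?_
  rw [hP.card_evalPt, Nat.cast_sub hP.M_lt.le, errBound]
  push_cast
  rw [div_mul_cancel₀ _ hP.errBound_denom_pos.ne']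
  have h1 : Nat.card {r : EvalPt P | p.eval r.1 = 0} ≤ Nat.card {x : P.E | p.eval x = 0} :=
    Nat.card_le_card_of_injective (fun r => ⟨r.1.1, r.2⟩) fun a b hab =>
      Subtype.ext (Subtype.ext (Subtype.mk.inj hab))
  have h2 := hP.card_roots_le hp hD
  push_cast at h2
  have h3 : (Nat.card {r : EvalPt P | p.eval r.1 = 0} : ℝ) ≤ Nat.card {x : P.E | p.eval x = 0} := by
    exact_mod_cast h1
  -- The root count gives the bound without the `+ 1` in the numerator of `errBound`, which is
  -- slack.
  linarith

/-- The reconstructed `p` and the polynomial `q` prescribed by the inputs are both fixed before `η`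
and `r`. If `p = q`, then `p` is non-zero at the point of the bad group and only the test with `η`
is needed; if `p ≠ q`, only the test at `r` is needed, as `p - q` has degree at most `2 * M`. -/
theorem cheatProbGiven_le (x x' : Fin P.m → Slot P.n → P.Z) (b b' : Fin P.L → Slot P.n → P.E)
    (θ : Fin P.L → P.E) (h : ∃ a, gCirc θ (grouped P (fun k s => x k s + x' k s) a) ≠ 0)
    (c c' : Fin (2 * P.M + 1) → P.E) :
    cheatProbGiven P θ x x' b b' c c' ≤ errBound P.ℓ P.d P.M (2 * P.M) := by
  obtain ⟨a, ha⟩ := h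
  have := hP.finite_E
  have := hP.finite_evalPt
  have := hP.nonempty_evalPt
  set p := ofCoeffs fun t => c t + c' t with hp
  set q := proofPoly P θ (fun k s => b k s + b' k s) fun k s => x k s + x' k s with hq
  rw [cheatProbGiven]
  simp only [accepted, accept_vMsg_iff, ← hp, ← hq]
  by_cases hpq : p = q
  · refine (prob_mono (B := {ω : (Fin P.M → P.E) × EvalPt P | ω.1 ∈ {η : Fin P.M → P.E |
      ∑ a : Fin P.M, η a * p.eval (pt P (a + 1)) = 0}}) fun ω h => h.1).trans ?_
    refine (prob_fst_le _).trans ((hP.prob_linear_le (i₀ := a) ?_).trans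
      (hP.inv_two_pow_le_errBound (by have := a.2; omega)))
    rw [hpq, hq, hP.eval_proofPoly_pt]
    exact ha
  · refine (prob_mono (B := {ω : (Fin P.M → P.E) × EvalPt P | ω.2 ∈ {r : EvalPt P |
      (p - q).eval r.1 = 0}}) fun ω h => ?_).trans ?_
    · simp only [Set.mem_ofPred_eq, eval_sub, sub_eq_zero]
      exact h.2
    · refine (prob_snd_le _).trans (hP.prob_roots_le (sub_ne_zero.2 hpq) ?_)
      exact (natDegree_sub_le _ _).trans
        (max_le (natDegree_ofCoeffs_le _) (natDegree_proofPoly_le _ _ _))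

theorem prob_gCirc_eq_zero_le (x : Fin P.m → Slot P.n → P.Z) (h : ∃ k, cCirc (x k) ≠ 0) :
    prob {θ | ∀ a, gCirc θ (grouped P x a) = 0} ≤ ((2 : ℝ) ^ P.d)⁻¹ := by
  have := hP.finite_E
  obtain ⟨k, hk⟩ := h
  have hL : 0 < P.L := by
    rcases Nat.eq_zero_or_pos P.L with h0 | h0
    · have := hP.groups
      rw [h0, zero_mul] at this
      have := k.2
      omega
    · exact h0
  -- The wrong message number `k` sits at position `k % L` of group `k / L`. The output of this
  -- group is a linear form in `θ` whose coefficient there is the image of a non-zero element of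
  -- `ℤ/2^ℓ`.
  have ha : k / P.L < P.M := Nat.div_lt_of_lt_mul (k.2.trans_le hP.groups)
  have hkk : k / P.L * P.L + k % P.L = k := Nat.div_add_mod' _ _
  refine (prob_mono (B := {θ : Fin P.L → P.E | ∑ i, θ i *
    cCirc (grouped P x ⟨k / P.L, ha⟩ i) = 0}) fun θ h =>
    (Set.mem_ofPred_eq.mp h : ∀ a, gCirc θ (grouped P x a) = 0) ⟨k / P.L, ha⟩).trans ?_
  refine hP.prob_linear_le (i₀ := ⟨k % P.L, Nat.mod_lt _ hL⟩) ?_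
  rw [cCirc_grouped]
  simp only [hkk, Fin.is_lt, dif_pos, Fin.eta]
  exact (map_ne_zero_iff _ hP.of_injective).2 hk

/-- Splitting over `θ`: outside the bad set where `θ` hides the error, the bound for given `θ`
applies to the fixed proof `c θ`. -/
theorem cheatProb_le (x x' : Fin P.m → Slot P.n → P.Z) (b b' : Fin P.L → Slot P.n → P.E)
    (h : Cheats P x x') (c : (Fin P.L → P.E) → Fin (2 * P.M + 1) → P.E)
    (c' : Fin (2 * P.M + 1) → P.E) :
    cheatProb P x x' b b' c c' ≤ ((2 : ℝ) ^ P.d)⁻¹ + errBound P.ℓ P.d P.M (2 * P.M) := by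
  have := hP.finite_E
  have := hP.finite_evalPt
  refine (prob_prod_le (fun θ => {ω : (Fin P.M → P.E) × EvalPt P |
    accepted P θ ω.1 ω.2 x x' b b' (c θ) c'})
    {θ | ∀ a, gCirc θ (grouped P (fun k s => x k s + x' k s) a) = 0}
    hP.errBound_nonneg fun θ hθ => ?_).trans
    (add_le_add_left (hP.prob_gCirc_eq_zero_le (fun k s => x k s + x' k s) h) _)
  refine hP.cheatProbGiven_le x x' b b' θ ?_ (c θ) c'
  simpa using hθ

end Par.Valid
end

/-! ### Composition of executions and worst-case communication -/

section
variable {S : Type}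

/-- The adversary `A` in an execution with `n` more rounds to follow. -/
def Adversary.shift (A : Adversary S) (n : ℕ) : Adversary S where
  corrupt := A.corrupt
  priv R k := A.priv R (k + n)
  bc R k := A.bc R (k + n)

theorem step_shift (A : Adversary S) (n : ℕ) (R : Round S) (k : ℕ) (σ : Srv → S) :
    step (A.shift n) R k σ = step A R (k + n) σ := rfl

theorem roundBits_shift (A : Adversary S) (n : ℕ) (R : Round S) (σ : Srv → S) (p : Srv) :
    roundBits (A.shift n) R σ p = roundBits A R σ p := rfl

/-- An adversary sees the number of rounds left, so on the first part it acts as one whose counter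
is shifted by the length of the second part. Honest executions are unaffected by the shift. -/
theorem run_append (A : Adversary S) (Rs Rs' : List (Round S)) (σ : Srv → S) :
    run A (Rs ++ Rs') σ = run A Rs' (run (A.shift Rs'.length) Rs σ) := by
  induction Rs generalizing σ with
  | nil => rfl
  | cons R Rs ih => simp [run, ih, step_shift]

theorem bits_append (A : Adversary S) (Rs Rs' : List (Round S)) (σ : Srv → S) (p : Srv) :
    bits A (Rs ++ Rs') σ p =
      bits (A.shift Rs'.length) Rs σ p + bits A Rs' (run (A.shift Rs'.length) Rs σ) p := by
  induction Rs generalizing σ with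
  | nil => simp [run, bits]
  | cons R Rs ih => simp [run, bits, ih, step_shift, roundBits_shift, add_assoc]

theorem run_honest_append (Rs Rs' : List (Round S)) (σ : Srv → S) :
    run (honest S) (Rs ++ Rs') σ = run (honest S) Rs' (run (honest S) Rs σ) := run_append _ _ _ _

theorem bits_honest_append (Rs Rs' : List (Round S)) (σ : Srv → S) (p : Srv) :
    bits (honest S) (Rs ++ Rs') σ p =
      bits (honest S) Rs σ p + bits (honest S) Rs' (run (honest S) Rs σ) p := bits_append _ _ _ _ _

/-- The state of a server after a round that everybody executes honestly. -/
def honestStep (R : Round S) (σ : Srv → S) (p : Srv) : S :=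
  R.recv p (σ p) (fun q => R.send q p (σ q)) fun q => R.bcast q (σ q)

theorem step_honest (R : Round S) (k : ℕ) (σ : Srv → S) :
    step (honest S) R k σ = honestStep R σ := rfl

/-- The number of bits communicated by a server that follows a round. -/
noncomputable def honestBits (R : Round S) (s : S) (p : Srv) : ℕ :=
  (∑ q : Srv, if q ≠ p ∧ (R.send p q s).isSome then bitLen (R.Priv p q) else 0) +
    (if (R.bcast p s).isSome then bitLen (R.Bc p) else 0)

theorem roundBits_honest (R : Round S) (σ : Srv → S) (p : Srv) :
    roundBits (honest S) R σ p = honestBits R (σ p) p := rfl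

theorem roundBits_le (A : Adversary S) (R : Round S) (σ : Srv → S) (p : Srv) :
    roundBits A R σ p ≤ honestBits R (σ p) p := by
  rw [roundBits]
  by_cases h : A.corrupt = some p
  · rw [if_pos h]
    exact Nat.zero_le _
  · rw [if_neg h]
    exact le_rfl

/-- Whatever happens, the honest servers send at most `b` bits. -/
def CostLe (Rs : List (Round S)) (b : ℕ) : Prop := ∀ A σ, totalBits A Rs σ ≤ b

/-- Bounds compose because `CostLe` quantifies over all adversaries and all starting states, in
particular those left behind by a malicious first part. -/
theorem CostLe.append {Rs Rs' : List (Round S)} {b b' : ℕ} (h : CostLe Rs b) (h' : CostLe Rs' b') :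
    CostLe (Rs ++ Rs') (b + b') := by
  intro A σ
  unfold totalBits
  simp only [bits_append, Finset.sum_add_distrib]
  exact add_le_add (h _ _) (h' _ _)

theorem costLe_nil : CostLe ([] : List (Round S)) 0 := fun _ _ => by simp [totalBits, bits]

theorem CostLe.cons {R : Round S} {Rs : List (Round S)} {b b' : ℕ}
    (h : ∀ σ : Srv → S, ∑ p, honestBits R (σ p) p ≤ b) (h' : CostLe Rs b') :
    CostLe (R :: Rs) (b + b') := by
  intro A σ
  simp only [totalBits, bits, Finset.sum_add_distrib]
  exact add_le_add ((Finset.sum_le_sum fun p _ => roundBits_le A R σ p).trans (h σ)) (h' _ _)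

/-- Private messages are sent only along the channels in `c`, with at most `b` bits each, and only
the servers in `c'` broadcast, at most `b'` bits. -/
theorem sum_honestBits_le {R : Round S} (σ : Srv → S) (c : Srv → Srv → Bool) (c' : Srv → Bool)
    {b b' : ℕ} (h : ∀ p q, q ≠ p → (R.send p q (σ p)).isSome → c p q = true ∧ bitLen (R.Priv p q) ≤ b)
    (h' : ∀ p, (R.bcast p (σ p)).isSome → c' p = true ∧ bitLen (R.Bc p) ≤ b') :
    ∑ p, honestBits R (σ p) p ≤
      (Finset.univ.filter fun x : Srv × Srv => c x.1 x.2 = true).card * b +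
        (Finset.univ.filter fun p : Srv => c' p = true).card * b' := by
  simp only [honestBits, Finset.sum_add_distrib]
  rw [← Finset.sum_product', Finset.univ_product_univ, Finset.card_filter, Finset.card_filter,
    Finset.sum_mul, Finset.sum_mul]
  refine add_le_add (Finset.sum_le_sum fun x _ => ?_) (Finset.sum_le_sum fun p _ => ?_)
  · split_ifs with h1 h2
    · rw [one_mul]
      exact (h _ _ h1.1 h1.2).2
    · exact absurd (h _ _ h1.1 h1.2).1 h2
    all_goals simp
  · split_ifs with h1 h2
    · rw [one_mul]
      exact (h' _ h1).2
    · exact absurd (h' _ h1).1 h2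
    all_goals simp

theorem bitLen_of_card {X : Type} {k : ℕ} (h : Nat.card X = 2 ^ k) : bitLen X = k := by
  rw [bitLen, h, Nat.clog_pow _ _ (by norm_num)]

theorem bitLen_bool : bitLen Bool = 1 := bitLen_of_card (by simp)

theorem bitLen_dig (κ : ℕ) : bitLen (Dig κ) = κ := bitLen_of_card (by simp [Dig])

theorem bitLen_acc : bitLen Acc = 3 := bitLen_of_card (by simp [Acc])

/-- The type has `2 ^ κ + 8` elements; for `κ = 0` the summand `4` cannot be lowered. -/
theorem bitLen_dig_sum_acc (κ : ℕ) : bitLen (Dig κ ⊕ Acc) ≤ κ + 4 := by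
  rw [bitLen, Nat.card_sum]
  refine Nat.clog_le_of_le_pow ?_
  have h1 : Nat.card (Dig κ) = 2 ^ κ := by simp [Dig]
  have h2 : Nat.card Acc = 8 := by simp [Acc]
  rw [h1, h2]
  have : 1 ≤ 2 ^ κ := Nat.one_le_two_pow
  rw [pow_add]
  omega

/-! ### The verify phase of joint message passing -/

section
variable {V : Type} {κ : ℕ} {i j k : Srv} {hash : V → Dig κ} {val : Srv → S → Option V}
  {get : S → Jmp κ} {put : S → Jmp κ → S}

theorem isSome_ite_none {α : Type} {c : Prop} [Decidable c] {o : Option α}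
    (h : (if c then o else none).isSome) : c := by
  by_contra hc
  simp [hc] at h

theorem costLe_jmpVerify : CostLe (jmpVerify i j k hash val get put) (4 * κ + 25) := by
  -- One bracket per round, as channels times message length plus broadcasters times broadcast
  -- length: a hash; two bits and one accusation; two bits and two accusations; three broadcasts of
  -- a hash or an accusation.
  have e : 4 * κ + 25 = (1 * κ + 0 * 0) + ((2 * 1 + 1 * 3) + ((2 * 1 + 2 * 3) +
      ((0 * 0 + 3 * (κ + 4)) + 0))) := by ring
  rw [e]
  refine .cons (fun σ => ?_) (.cons (fun σ => ?_) (.cons (fun σ => ?_) (.cons (fun σ => ?_)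
    costLe_nil)))
  · refine (sum_honestBits_le σ (fun p q => p = j ∧ q = k) (fun _ => false) (b := κ) (b' := 0)
      (fun p q _ h => ⟨?_, (bitLen_dig κ).le⟩) (fun p h => absurd h (by simp [jmpHash]))).trans ?_
    · simpa using (isSome_ite_none h).2
    · gcongr
      · revert j k; decide
      · simp
  · refine (sum_honestBits_le σ (fun p q => p = k ∧ (q = i ∨ q = j)) (fun p => p = k)
      (b := 1) (b' := 3)
      (fun p q _ h => ⟨?_, bitLen_bool.le⟩) (fun p h => ⟨?_, bitLen_acc.le⟩)).trans ?_
    · simpa using (isSome_ite_none h).2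
    · simpa using (isSome_ite_none h).2
    · gcongr
      · revert i j k; decide
      · revert k; decide
  · refine (sum_honestBits_le σ (fun p q => (p = i ∧ q = j) ∨ (p = j ∧ q = i))
      (fun p => p = i ∨ p = j) (b := 1) (b' := 3)
      (fun p q _ h => ⟨?_, bitLen_bool.le⟩) (fun p h => ⟨?_, bitLen_acc.le⟩)).trans ?_
    · simpa using (isSome_ite_none h).2
    · simpa using (isSome_ite_none h).2.1
    · gcongr
      · revert i j; decide
      · revert i j; decide
  · refine (sum_honestBits_le σ (fun _ _ => false) (fun _ => true) (b := 0) (b' := κ + 4)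
      (fun p q _ h => absurd h (by simp [jmpResolve]))
      (fun p h => ⟨rfl, bitLen_dig_sum_acc κ⟩)).trans ?_
    simp

/-- `put` and `get` access a component of the state that is independent of the value. -/
structure JmpAccess (val : Srv → S → Option V) (get : S → Jmp κ) (put : S → Jmp κ → S) : Prop where
  get_put : ∀ s J, get (put s J) = J
  put_put : ∀ s J J', put (put s J) J' = put s J'
  val_put : ∀ p s J, val p (put s J) = val p s

variable {σ : Srv → S} {w : V}

theorem Srv.eq_or {i j k : Srv} (hij : i ≠ j) (hik : i ≠ k) (hjk : j ≠ k) (p : Srv) :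
    p = i ∨ p = j ∨ p = k := by
  revert i j k p; decide

/-- Together with the next lemmas this computes a verify phase in which all servers hold `w`: each
round only replaces the record by an explicit one, so the rounds can be chained by rewriting. -/
theorem jmpHash_honest (h0 : ∀ p, (get (σ p)).ttp = none)
    (hv : ∀ p, val p (σ p) = some w) :
    honestStep (jmpHash j k hash val get put) σ = fun p =>
      put (σ p) ⟨if p = k then some (hash w) else none, none, none, none⟩ := by
  funext p
  by_cases hp : p = k <;> simp [honestStep, jmpHash, h0, hv, hp]

theorem jmpBit_honest (hij : i ≠ j) (hik : i ≠ k) (hjk : j ≠ k) (ha : JmpAccess val get put)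
    (hv : ∀ p, val p (σ p) = some w) :
    honestStep (jmpBit i j k hash val get put) (fun p =>
      put (σ p) ⟨if p = k then some (hash w) else none, none, none, none⟩) = fun p =>
      put (σ p) ⟨if p = k then some (hash w) else none, some false, none, none⟩ := by
  funext p
  have hp := Srv.eq_or hij hik hjk p
  have hk : ¬ p = k → p = i ∨ p = j := fun h => by tauto
  by_cases hp : p = k
  · simp [honestStep, jmpBit, ha.get_put, ha.put_put, ha.val_put, hv, hp, inconsistent, accuses,
      accusation, hik.symm, hjk.symm]
  · simp [honestStep, jmpBit, ha.get_put, ha.put_put, ha.val_put, hv, hp, hk hp, inconsistent,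
      accuses, accusation]

theorem jmpExchange_honest (hij : i ≠ j) (ha : JmpAccess val get put) :
    honestStep (jmpExchange i j k get put) (fun p =>
      put (σ p) ⟨if p = k then some (hash w) else none, some false, none, none⟩) = fun p =>
      put (σ p) ⟨if p = k then some (hash w) else none, some false,
        if p = i ∨ p = j then some false else none, none⟩ := by
  funext p
  by_cases hp : p = i
  · simp [honestStep, jmpExchange, ha.get_put, ha.put_put, hp, accuses, hij]
  · by_cases hq : p = j
    · simp [honestStep, jmpExchange, ha.get_put, ha.put_put, hq, accuses, hij.symm]
    · simp [honestStep, jmpExchange, ha.get_put, ha.put_put, hp, hq, accuses]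

/-- All inconsistency bits are off and both senders have heard from their fellow, so there is
neither a hash to broadcast nor anybody to accuse. -/
theorem jmpResolve_bcast (hij : i ≠ j) (hik : i ≠ k) (hjk : j ≠ k) (ha : JmpAccess val get put)
    (p : Srv) : (jmpResolve i j k hash val get put).bcast p
      (put (σ p) ⟨if p = k then some (hash w) else none, some false,
        if p = i ∨ p = j then some false else none, none⟩) = none := by
  have hp := Srv.eq_or hij hik hjk p
  have hk : ¬ p = k → p = i ∨ p = j := fun h => by tauto
  by_cases hp : p = k
  · simp [jmpResolve, ha.get_put, hp]
  · simp [jmpResolve, ha.get_put, hp, hk hp]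

theorem jmpResolve_honest (hij : i ≠ j) (hik : i ≠ k) (hjk : j ≠ k) (ha : JmpAccess val get put) :
    honestStep (jmpResolve i j k hash val get put) (fun p =>
      put (σ p) ⟨if p = k then some (hash w) else none, some false,
        if p = i ∨ p = j then some false else none, none⟩) = fun p =>
      put (σ p) ⟨if p = k then some (hash w) else none, some false,
        if p = i ∨ p = j then some false else none, none⟩ := by
  funext p
  have hb := jmpResolve_bcast (σ := σ) (w := w) (hash := hash) hij hik hjk ha
  simp only [honestStep, hb]
  simp [jmpResolve, ha.get_put, ha.put_put, bcAcc, bcHash, accuses, pickTTP]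

/-- The verify phase of joint message passing selects nobody if all servers hold the same value. -/
theorem jmpVerify_run (hij : i ≠ j) (hik : i ≠ k) (hjk : j ≠ k) (ha : JmpAccess val get put)
    (h0 : ∀ p, (get (σ p)).ttp = none) (hv : ∀ p, val p (σ p) = some w) :
    ∃ J : Srv → Jmp κ, (∀ p, (J p).ttp = none) ∧
      run (honest S) (jmpVerify i j k hash val get put) σ = fun p => put (σ p) (J p) := by
  refine ⟨fun p => ⟨if p = k then some (hash w) else none, some false,
        if p = i ∨ p = j then some false else none, none⟩, fun p => rfl, ?_⟩
  simp only [jmpVerify, run, step_honest]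
  rw [jmpHash_honest h0 hv, jmpBit_honest hij hik hjk ha hv, jmpExchange_honest hij ha,
    jmpResolve_honest hij hik hjk ha]

/-- `P_j` pays for the hash, `P_k` for two inconsistency bits, and each sender for forwarding its
bit to the other: `κ + 4` bits in all. -/
theorem jmpVerify_bits (hij : i ≠ j) (hik : i ≠ k) (hjk : j ≠ k) (ha : JmpAccess val get put)
    (h0 : ∀ p, (get (σ p)).ttp = none) (hv : ∀ p, val p (σ p) = some w) (p : Srv) :
    bits (honest S) (jmpVerify i j k hash val get put) σ p =
      if p = j then κ + 1 else if p = i then 1 else 2 := by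
  simp only [jmpVerify, bits, step_honest, roundBits_honest]
  rw [jmpHash_honest h0 hv, jmpBit_honest hij hik hjk ha hv, jmpExchange_honest hij ha]
  simp only [honestBits, jmpResolve_bcast hij hik hjk ha]
  simp only [jmpHash, jmpBit, jmpExchange, jmpResolve, h0, hv, ha.get_put, ha.val_put, bitLen_dig,
    bitLen_bool, accusation, inconsistent]
  fin_cases i <;> fin_cases j <;> first | exact absurd rfl hij | skip
  all_goals fin_cases k <;> first | exact absurd rfl hik | exact absurd rfl hjk | skip
  all_goals fin_cases p <;> simp [Fin.sum_univ_three] <;> rfl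

end
end

/-! ### Cost and honest execution of one proof -/

section
variable {P : Par}

theorem bitLen_Z : bitLen P.Z = P.ℓ := bitLen_of_card (Nat.card_zmod _)

theorem bitLen_fun_zmod {ℓ : ℕ} {ι : Type} [Finite ι] :
    bitLen (ι → ZMod (2 ^ ℓ)) = Nat.card ι * ℓ :=
  bitLen_of_card (by rw [Nat.card_fun, Nat.card_zmod, ← pow_mul, mul_comm])

namespace Par.Valid
variable (hP : P.Valid)
include hP

theorem bitLen_E : bitLen P.E = P.ℓ * P.d := bitLen_of_card hP.card_E

theorem bitLen_fun_E {N : ℕ} : bitLen (Fin N → P.E) = N * (P.ℓ * P.d) :=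
  bitLen_of_card (by rw [Nat.card_fun, hP.card_E, Nat.card_fin, ← pow_mul, mul_comm])

theorem bitLen_vMsg : bitLen (VMsg P) = (P.u * P.L + 2) * (P.ℓ * P.d) := by
  refine bitLen_of_card ?_
  rw [Nat.card_prod, Nat.card_prod, Nat.card_fun, Nat.card_fun, hP.card_E, Nat.card_fin,
    Nat.card_sum, Nat.card_prod, Nat.card_fin, Nat.card_fin, Nat.card_fin, ← pow_mul, ← pow_mul,
    ← pow_add, ← pow_add]
  congr 1
  ring

theorem costLe_proveRounds (hash : VMsg P → Dig P.κ) (i : Srv) :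
    CostLe (proveRounds hash i)
      ((P.u * P.L + 2 * P.M + 3) * (P.ℓ * P.d) + (4 * P.κ + 25)) := by
  -- The prover sends `2 * M + 1` coefficients and the verifier `P_{i+1}` one evaluation per input
  -- wire of `g` plus two further ring elements.
  have e : (P.u * P.L + 2 * P.M + 3) * (P.ℓ * P.d) + (4 * P.κ + 25) =
      ((1 * ((2 * P.M + 1) * (P.ℓ * P.d)) + 0 * 0) +
        ((1 * ((P.u * P.L + 2) * (P.ℓ * P.d)) + 0 * 0) + 0)) + (4 * P.κ + 25) := by ring
  rw [e]
  refine CostLe.append (.cons (fun σ => ?_) (.cons (fun σ => ?_) costLe_nil)) costLe_jmpVerify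
  · refine (sum_honestBits_le σ (fun p q => p = i ∧ q = i + 1) (fun _ => false)
      (b := (2 * P.M + 1) * (P.ℓ * P.d)) (b' := 0) (fun p q _ h => ⟨?_, hP.bitLen_fun_E.le⟩)
      (fun p h => absurd h (by simp [proofRound]))).trans ?_
    · simpa using (isSome_ite_none h).2
    · gcongr
      · revert i; decide
      · simp
  · refine (sum_honestBits_le σ (fun p q => p = i + 1 ∧ q = i - 1) (fun _ => false)
      (b := (P.u * P.L + 2) * (P.ℓ * P.d)) (b' := 0) (fun p q _ h => ⟨?_, hP.bitLen_vMsg.le⟩)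
      (fun p h => absurd h (by simp [verifierRound]))).trans ?_
    · simpa using (isSome_ite_none h).2
    · gcongr
      · revert i; decide
      · simp

theorem costLe_dotPPre (hash : VMsg P → Dig P.κ) : CostLe (dotPPre hash)
    (P.m * (3 * P.ℓ) + 3 * (P.u * P.L + 2 * P.M + 3) * (P.ℓ * P.d) + 3 * (4 * P.κ + 25)) := by
  have h := hP.costLe_proveRounds hash
  have h' := CostLe.cons (R := semiHonest) (b := 3 * (P.m * P.ℓ) + 0 * 0) (fun σ => ?_)
    (((h 0).append (h 1)).append (h 2))
  · refine fun A σ => (h' A σ).trans (le_of_eq ?_)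
    ring
  · refine (sum_honestBits_le σ (fun p q => q = p - 1) (fun _ => false)
      (b := P.m * P.ℓ) (b' := 0)
      (fun p q _ h => ⟨?_, (bitLen_fun_zmod.trans (by rw [Nat.card_fin])).le⟩)
      (fun p h => absurd h (by simp [semiHonest]))).trans ?_
    · simpa using isSome_ite_none h
    · gcongr
      · decide
      · simp

end Par.Valid

/-- The state of a server after some proofs. -/
def PreSt.after (s : PreSt P) (c : Fin (2 * P.M + 1) → P.E) (w : Option (VMsg P)) (J : Jmp P.κ) :
    PreSt P :=
  { s with cOfPrev := c, msg := w, jmp := J }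

/-- The message of the verifier `P_{i+1}` in an honest execution. -/
noncomputable def verifierMsg (σ : Srv → PreSt P) (i : Srv) : VMsg P :=
  vMsg P ((σ i).η i) ((σ i).r i) ((σ i).proof i) (σ i).bNext (σ i).xNextKnown

/-- The received shares of the coefficients after the proof of `P_i`. -/
noncomputable def coeffsAfter (σ : Srv → PreSt P) (i : Srv) (c : Srv → Fin (2 * P.M + 1) → P.E) (p : Srv) :
    Fin (2 * P.M + 1) → P.E :=
  if p = i + 1 then (σ i).proof i else c p

/-- The received messages of verifiers after the proof of `P_i`. -/
noncomputable def msgsAfter (σ : Srv → PreSt P) (i : Srv) (w : Srv → Option (VMsg P)) (p : Srv) :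
    Option (VMsg P) :=
  if p = i - 1 then some (verifierMsg σ i) else w p

/-- The states agree on the shared values as prescribed. -/
structure Consistent (σ : Srv → PreSt P) : Prop where
  η : ∀ p q, (σ p).η = (σ q).η
  r : ∀ p q, (σ p).r = (σ q).r
  b : ∀ i, (σ (i + 1)).bOfPrev = (σ i).bNext
  x : ∀ i, (σ (i + 1)).xOfPrev = (σ i).xNextKnown

theorem srv_add_one_ne (i : Srv) : i + 1 ≠ i ∧ i + 1 ≠ i - 1 ∧ i ≠ i - 1 := by
  revert i; decide

theorem PreSt.jmpAccess (i : Srv) : JmpAccess (verifierValue (P := P) i) PreSt.jmp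
    (fun s J => { s with jmp := J }) where
  get_put _ _ := rfl
  put_put _ _ _ := rfl
  val_put _ _ _ := rfl

section
variable {σ : Srv → PreSt P} {c : Srv → Fin (2 * P.M + 1) → P.E} {w : Srv → Option (VMsg P)}
  {J : Srv → Jmp P.κ} (i : Srv)

theorem proofRound_honest (hJ : ∀ p, (J p).ttp = none) :
    honestStep (proofRound i) (fun p => (σ p).after (c p) (w p) (J p)) = fun p =>
      (σ p).after (coeffsAfter σ i c p) (w p) (J p) := by
  funext p
  by_cases hp : p = i + 1
  · subst hp
    simp [honestStep, proofRound, PreSt.after, coeffsAfter, hJ]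
    rfl
  · simp [honestStep, proofRound, coeffsAfter, hp]

/-- Everything entering the message of `P_{i+1}` is known to the prover: the coefficients it sent,
the common randomness and its own replicated shares. This is what allows the message to be passed
jointly. -/
theorem verifierValue_sender (hσ : Consistent σ) (hc : c (i + 1) = (σ i).proof i)
    {w : Option (VMsg P)} {J : Jmp P.κ} :
    verifierValue i (i + 1) ((σ (i + 1)).after (c (i + 1)) w J) = some (verifierMsg σ i) := by
  have h : verifierValue i (i + 1) ((σ (i + 1)).after (c (i + 1)) w J) =
    some (vMsg P ((σ (i + 1)).η i) ((σ (i + 1)).r i) (c (i + 1)) (σ (i + 1)).bOfPrev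
      (σ (i + 1)).xOfPrev) := if_pos rfl
  rw [h, hc, hσ.b, hσ.x, hσ.η (i + 1) i, hσ.r (i + 1) i]
  rfl

theorem verifierRound_honest (hσ : Consistent σ) (hc : c (i + 1) = (σ i).proof i)
    (hJ : ∀ p, (J p).ttp = none) :
    honestStep (verifierRound i) (fun p => (σ p).after (c p) (w p) (J p)) = fun p =>
      (σ p).after (c p) (msgsAfter σ i w p) (J p) := by
  funext p
  by_cases hp : p = i - 1
  · subst hp
    have hs := verifierValue_sender (w := w (i + 1)) (J := J (i + 1)) i hσ hc
    simp only [honestStep, verifierRound, hs]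
    simp [PreSt.after, msgsAfter, hJ]
  · simp [honestStep, verifierRound, msgsAfter, hp]

theorem verifierValue_eq (hσ : Consistent σ) (hc : c (i + 1) = (σ i).proof i)
    (hw : w (i - 1) = some (verifierMsg σ i)) (p : Srv) :
    verifierValue i p ((σ p).after (c p) (w p) (J p)) = some (verifierMsg σ i) := by
  obtain ⟨h1, h2, h3⟩ := srv_add_one_ne i
  rcases Srv.eq_or h1 h2 h3 p with rfl | rfl | rfl
  · exact verifierValue_sender i hσ hc
  · rw [verifierValue, if_neg h1.symm, if_pos rfl]
    rfl
  · rw [verifierValue, if_neg h2.symm, if_neg h3.symm]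
    exact hw

variable (hash : VMsg P → Dig P.κ)

/-- A proof modifies only the received coefficients, the received message and the record, none of
which enters `Consistent`. With arbitrary `c`, `w`, `J` the lemma therefore applies to each of the
three successive proofs. -/
theorem run_proveRounds (hσ : Consistent σ) (hJ : ∀ p, (J p).ttp = none) :
    ∃ J' : Srv → Jmp P.κ, (∀ p, (J' p).ttp = none) ∧
      run (honest _) (proveRounds hash i) (fun p => (σ p).after (c p) (w p) (J p)) = fun p =>
        (σ p).after (coeffsAfter σ i c p) (msgsAfter σ i w p) (J' p) := by
  obtain ⟨h1, h2, h3⟩ := srv_add_one_ne i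
  have hc : coeffsAfter σ i c (i + 1) = (σ i).proof i := if_pos rfl
  have hw : msgsAfter σ i w (i - 1) = some (verifierMsg σ i) := if_pos rfl
  obtain ⟨J', hJ', h⟩ := jmpVerify_run (hash := hash) h1 h2 h3 (PreSt.jmpAccess (P := P) i) hJ
    (verifierValue_eq (J := J) i hσ hc hw)
  refine ⟨J', hJ', ?_⟩
  rw [proveRounds, run_honest_append]
  simp only [run, step_honest]
  rw [proofRound_honest i hJ, verifierRound_honest i hσ hc hJ, h]
  rfl

theorem bits_proveRounds (hP : P.Valid) (hσ : Consistent σ) (hJ : ∀ p, (J p).ttp = none) (p : Srv) :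
    bits (honest _) (proveRounds hash i) (fun p => (σ p).after (c p) (w p) (J p)) p =
      (if p = i then (2 * P.M + 1) * (P.ℓ * P.d) else 0) +
      (if p = i + 1 then (P.u * P.L + 2) * (P.ℓ * P.d) else 0) +
      if p = i then P.κ + 1 else if p = i + 1 then 1 else 2 := by
  obtain ⟨h1, h2, h3⟩ := srv_add_one_ne i
  have hc : coeffsAfter σ i c (i + 1) = (σ i).proof i := if_pos rfl
  have hw : msgsAfter σ i w (i - 1) = some (verifierMsg σ i) := if_pos rfl
  rw [proveRounds, bits_honest_append]
  simp only [run, step_honest, bits, roundBits_honest]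
  rw [proofRound_honest i hJ, verifierRound_honest i hσ hc hJ,
    jmpVerify_bits (hash := hash) h1 h2 h3 (PreSt.jmpAccess (P := P) i) hJ
      (verifierValue_eq (J := J) i hσ hc hw)]
  refine congrArg₂ (· + ·) (congrArg₂ (· + ·) ?_ ?_) rfl
  · have hb : bitLen (Fin (2 * P.M + 1) → P.E) = (2 * P.M + 1) * (P.ℓ * P.d) := hP.bitLen_fun_E
    have hj : ((σ p).after (c p) (w p) (J p)).jmp.ttp = none := hJ p
    simp only [honestBits, proofRound, hb, hj]
    by_cases hp : p = i
    · subst hp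
      simp [h1, Finset.sum_ite, Finset.filter_and, Finset.filter_eq']
    · simp [hp]
  · have hj : ((σ p).after (coeffsAfter σ i c p) (w p) (J p)).jmp.ttp = none :=
      hJ p
    simp only [honestBits, verifierRound, hP.bitLen_vMsg, hj]
    by_cases hp : p = i + 1
    · subst hp
      simp [verifierValue, h2.symm, Finset.sum_ite, Finset.filter_and, Finset.filter_eq']
    · simp [hp]

end
end

/-! ### The honest preprocessing: correctness, acceptance and cost -/

section
variable {P : Par} (dv ev : Srv → Fin P.m → Fin P.n → P.Z) (τ : Tape P)

/-- The state after the semi-honest dot products. -/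
noncomputable def semiHonestState (p : Srv) : PreSt P :=
  { preInit dv ev τ p with
    fLo := (preInit dv ev τ p).share
    fHi := (preInit dv ev τ (p + 1)).share }

theorem semiHonest_honest : honestStep semiHonest (preInit dv ev τ) = semiHonestState dv ev τ := by
  funext p
  simp [honestStep, semiHonest, semiHonestState]

theorem bits_semiHonest (σ : Srv → PreSt P) (p : Srv) :
    bits (honest _) [semiHonest] σ p = P.m * P.ℓ := by
  have hb : bitLen (Fin P.m → P.Z) = P.m * P.ℓ := bitLen_fun_zmod.trans (by rw [Nat.card_fin])
  have hp : p - 1 ≠ p := by revert p; decide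
  simp [bits, roundBits_honest, honestBits, semiHonest, hb, Finset.sum_ite, Finset.filter_and,
    Finset.filter_eq', Finset.filter_ne', Finset.inter_singleton_of_mem, hp]

/-- The sharings of zero telescope around the cycle, and each of the nine products of a share of `d`
with a share of `e` is computed by exactly one server. -/
theorem sum_share (k : Fin P.m) : ∑ s, (preInit dv ev τ s).share k =
    ∑ j, (∑ s, dv s k j) * (∑ s, ev s k j) := by
  have h0 : (0 : Srv) - 1 = 2 := rfl
  have h1 : (1 : Srv) - 1 = 0 := rfl
  have h2 : (2 : Srv) - 1 = 1 := rfl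
  have h3 : (1 : Srv) + 1 = 2 := rfl
  have h4 : (2 : Srv) + 1 = 0 := rfl
  simp only [Fin.sum_univ_three, PreSt.share, preInit, h0, h1, h2, h3, h4, zero_add]
  have : ∀ a b c x y z : P.Z, (a - c + x) + (b - a + y) + (c - b + z) = x + y + z := by
    intros; ring
  rw [this, ← Finset.sum_add_distrib, ← Finset.sum_add_distrib]
  exact Finset.sum_congr rfl fun j _ => by ring

theorem consistent_semiHonest : Consistent (semiHonestState dv ev τ) where
  η _ _ := rfl
  r _ _ := rfl
  b i := by simp [semiHonestState, preInit]
  x i := by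
    funext k
    simp [semiHonestState, preInit, PreSt.xOfPrev, PreSt.xNextKnown]

theorem run_proveRounds_zero_one (hash : VMsg P → Dig P.κ) : ∃ J₀ J₁ : Srv → Jmp P.κ,
    (∀ p, (J₀ p).ttp = none) ∧ (∀ p, (J₁ p).ttp = none) ∧
    let σ := semiHonestState dv ev τ
    let c₀ := coeffsAfter σ 0 0
    let w₀ := msgsAfter σ 0 fun _ => none
    run (honest _) (proveRounds hash 0) σ = (fun p => (σ p).after (c₀ p) (w₀ p) (J₀ p)) ∧
    run (honest _) (proveRounds hash 1) (fun p => (σ p).after (c₀ p) (w₀ p) (J₀ p)) =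
      fun p => (σ p).after (coeffsAfter σ 1 c₀ p) (msgsAfter σ 1 w₀ p) (J₁ p) := by
  have hσ := consistent_semiHonest dv ev τ
  -- The state after the semi-honest part is of the form `after` with the initial values of the
  -- three fields, by definition.
  obtain ⟨J₀, h₀, e₀⟩ := run_proveRounds (c := 0) (w := fun _ => none) 0 hash hσ
    (J := fun _ => Jmp.start P.κ) fun _ => rfl
  obtain ⟨J₁, h₁, e₁⟩ := run_proveRounds (c := coeffsAfter (semiHonestState dv ev τ) 0 0)
    (w := msgsAfter (semiHonestState dv ev τ) 0 fun _ => none) 1 hash hσ h₀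
  exact ⟨J₀, J₁, h₀, h₁, e₀, e₁⟩

theorem run_dotPPre (hash : VMsg P → Dig P.κ) : ∃ (c : Srv → Fin (2 * P.M + 1) → P.E)
    (J : Srv → Jmp P.κ), (∀ p, (J p).ttp = none) ∧
    run (honest _) (dotPPre hash) (preInit dv ev τ) = fun p => (semiHonestState dv ev τ p).after (c p)
      (some (verifierMsg (semiHonestState dv ev τ) (p + 1))) (J p) := by
  have hσ := consistent_semiHonest dv ev τ
  rw [dotPPre, run, step_honest, semiHonest_honest, verification]
  obtain ⟨J₀, J₁, h₀, h₁, e₀, e₁⟩ := run_proveRounds_zero_one dv ev τ hash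
  obtain ⟨J₂, h₂, e₂⟩ := run_proveRounds 2 hash hσ h₁
    (c := coeffsAfter (semiHonestState dv ev τ) 1 (coeffsAfter (semiHonestState dv ev τ) 0 0))
    (w := msgsAfter (semiHonestState dv ev τ) 1 (msgsAfter (semiHonestState dv ev τ) 0 fun _ => none))
  refine ⟨coeffsAfter (semiHonestState dv ev τ) 2 (coeffsAfter (semiHonestState dv ev τ) 1
    (coeffsAfter (semiHonestState dv ev τ) 0 0)), J₂, h₂, ?_⟩
  rw [run_honest_append, run_honest_append, e₀, e₁, e₂]
  funext p
  congr 1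
  -- Every server is the deciding verifier exactly once, for the prover `P_{p+1}`, so no message is
  -- overwritten.
  fin_cases p <;> rfl

/-- Each server plays each of the three roles once, which makes the cost the same for all of them;
the verify phases contribute `(κ + 1) + 1 + 2` bits. -/
theorem bits_verification (hP : P.Valid) (hash : VMsg P → Dig P.κ) (p : Srv) :
    bits (honest _) (verification hash) (semiHonestState dv ev τ) p =
      (P.u * P.L + 2 * P.M + 3) * (P.ℓ * P.d) + (P.κ + 4) := by
  have hσ := consistent_semiHonest dv ev τ
  obtain ⟨J₀, J₁, h₀, h₁, e₀, e₁⟩ := run_proveRounds_zero_one dv ev τ hash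
  have b₀ := bits_proveRounds (c := 0) (w := fun _ => none) 0 hash hP hσ
    (J := fun _ => Jmp.start P.κ) (fun _ => rfl) p
  have b₁ := bits_proveRounds (c := coeffsAfter (semiHonestState dv ev τ) 0 0)
    (w := msgsAfter (semiHonestState dv ev τ) 0 fun _ => none) 1 hash hP hσ h₀ p
  have b₂ := bits_proveRounds 2 hash hP hσ h₁ p
    (c := coeffsAfter (semiHonestState dv ev τ) 1 (coeffsAfter (semiHonestState dv ev τ) 0 0))
    (w := msgsAfter (semiHonestState dv ev τ) 1 (msgsAfter (semiHonestState dv ev τ) 0 fun _ => none))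
  rw [verification, bits_honest_append, bits_honest_append, run_honest_append, e₀, e₁]
  refine (congrArg₂ (· + ·) (congrArg₂ (· + ·) b₀ b₁) b₂).trans ?_
  have h4 : (2 : Srv) + 1 = 0 := rfl
  have h3 : (1 : Srv) + 1 = 2 := rfl
  fin_cases p <;> simp [h4, h3] <;> ring

/-- On each wire the verifiers' shares are complementary. Only the wire of the zero sharing is
really split between them; any other is held by one verifier. -/
theorem xProver_eq (p : Srv) (k : Fin P.m) (s : Slot P.n) :
    (semiHonestState dv ev τ (p + 1)).xNextKnown k s + (semiHonestState dv ev τ p).xOfNext k s =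
      (semiHonestState dv ev τ (p + 1)).xProver k s := by
  rcases s with ⟨t, j⟩ | t
  · fin_cases t <;> simp [PreSt.xNextKnown, PreSt.xOfNext, PreSt.xProver, slots, semiHonestState,
      preInit]
  · fin_cases t <;> simp [PreSt.xNextKnown, PreSt.xOfNext, PreSt.xProver, slots, semiHonestState,
      preInit, sub_eq_add_neg]

theorem cCirc_xProver (p : Srv) (k : Fin P.m) :
    cCirc ((semiHonestState dv ev τ p).xProver k) = 0 := by
  unfold cCirc
  exact sub_self _

/-- The coefficient shares add up to the proof polynomial itself, so the identity at `r` is trivial.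
Its values at the points `1, …, M` are outputs of `g` on correct messages or on padding, hence zero.
-/
theorem accepts_after (hP : P.Valid) (p : Srv) (c : Fin (2 * P.M + 1) → P.E) (J : Jmp P.κ) :
    ((semiHonestState dv ev τ p).after c
      (some (verifierMsg (semiHonestState dv ev τ) (p + 1))) J).accepts p := by
  refine ⟨_, rfl, ?_⟩
  refine (accept_vMsg_iff (P := P) (τ.θ (p + 1)) (τ.η (p + 1)) (τ.r (p + 1)) _ _ _ _ _ _).2 ?_
  have hx : (fun k s => (semiHonestState dv ev τ (p + 1)).xNextKnown k s +
      (semiHonestState dv ev τ p).xOfNext k s) = (semiHonestState dv ev τ (p + 1)).xProver := by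
    funext k s
    exact xProver_eq dv ev τ p k s
  have hc : (ofCoeffs fun t => (semiHonestState dv ev τ (p + 1)).proof (p + 1) t + τ.c (p + 1) t) =
      proofPoly P (τ.θ (p + 1)) (fun k w => τ.bNext (p + 1) k w + τ.bPrev (p + 1) k w)
        (semiHonestState dv ev τ (p + 1)).xProver := by
    rw [← ofCoeffs_coeff (Nat.lt_succ_of_le (natDegree_proofPoly_le (P := P) (τ.θ (p + 1))
      (fun k w => τ.bNext (p + 1) k w + τ.bPrev (p + 1) k w)
      (semiHonestState dv ev τ (p + 1)).xProver))]
    exact congrArg ofCoeffs (funext fun t => sub_add_cancel _ _)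
  change ∑ a : Fin P.M, τ.η (p + 1) a * (ofCoeffs fun t =>
      (semiHonestState dv ev τ (p + 1)).proof (p + 1) t + τ.c (p + 1) t).eval (pt P (a + 1)) = 0 ∧
    (ofCoeffs fun t => (semiHonestState dv ev τ (p + 1)).proof (p + 1) t +
      τ.c (p + 1) t).eval (τ.r (p + 1)) =
    (proofPoly P (τ.θ (p + 1)) (fun k w => τ.bNext (p + 1) k w + τ.bPrev (p + 1) k w)
      (fun k s => (semiHonestState dv ev τ (p + 1)).xNextKnown k s +
        (semiHonestState dv ev τ p).xOfNext k s)).eval (τ.r (p + 1))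
  rw [hx, hc]
  refine ⟨Finset.sum_eq_zero fun a _ => ?_, rfl⟩
  rw [hP.eval_proofPoly_pt, gCirc, Finset.sum_eq_zero, mul_zero]
  intro k _
  rw [cCirc_grouped]
  split_ifs
  · rw [cCirc_xProver, map_zero, mul_zero]
  · rw [mul_zero]

theorem run_semiHonest : run (honest _) [semiHonest] (preInit dv ev τ) = semiHonestState dv ev τ := by
  rw [run, step_honest, semiHonest_honest, run]

theorem totalBits_dotPPre (hP : P.Valid) (hash : VMsg P → Dig P.κ) :
    totalBits (honest _) (dotPPre hash) (preInit dv ev τ) =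
      P.m * (3 * P.ℓ) + 3 * (P.u * P.L + 2 * P.M + 3) * (P.ℓ * P.d) + 3 * (P.κ + 4) := by
  have h : ∀ p, bits (honest _) (dotPPre hash) (preInit dv ev τ) p =
      P.m * P.ℓ + ((P.u * P.L + 2 * P.M + 3) * (P.ℓ * P.d) + (P.κ + 4)) := by
    intro p
    rw [← bits_verification dv ev τ hP hash p, ← bits_semiHonest (preInit dv ev τ) p,
      ← run_semiHonest]
    exact bits_honest_append [semiHonest] (verification hash) _ p
  simp only [totalBits, h, Finset.sum_const, Finset.card_univ, Fintype.card_fin, smul_eq_mul]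
  ring

end

/-! ### The online phase -/

section
variable {n m T I ℓ κ : ℕ} (K : DotCircuit n m T I)

theorem sum_card_layer : ((List.finRange T).map fun t => Nat.card {g : Fin m // K.layer g = t}).sum
    = m := by
  rw [← List.ofFn_eq_map, List.sum_ofFn, ← Nat.card_sigma,
    Nat.card_congr (Equiv.sigmaFiberEquiv K.layer), Nat.card_fin]

theorem costLe_layers (l : List (Fin T)) : CostLe (S := OnSt ℓ κ m I) (l.map (layerRound K))
    ((l.map fun t => Nat.card {g : Fin m // K.layer g = t}).sum * (2 * ℓ)) := by
  induction l with
  | nil => simpa using costLe_nil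
  | cons t l ih =>
    rw [List.map_cons, List.map_cons, List.sum_cons, add_mul]
    refine .cons (fun σ => ?_) ih
    refine (sum_honestBits_le σ (fun p q => (p = 1 ∧ q = 2) ∨ (p = 2 ∧ q = 1)) (fun _ => false)
      (b := Nat.card {g : Fin m // K.layer g = t} * ℓ) (b' := 0)
      (fun p q _ h => ⟨?_, bitLen_fun_zmod.le⟩)
      (fun p h => absurd h (by simp [layerRound]))).trans ?_
    · by_contra hc
      simp only [decide_eq_true_eq, not_or] at hc
      simp [layerRound, hc.1, hc.2] at h
    · have : (Finset.univ.filter fun x : Srv × Srv =>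
        decide ((x.1 = 1 ∧ x.2 = 2) ∨ (x.1 = 2 ∧ x.2 = 1)) = true).card = 2 := by decide
      rw [this]
      refine le_of_eq ?_
      ring

theorem bits_layers (l : List (Fin T)) (σ : Srv → OnSt ℓ κ m I) (p : Srv) :
    bits (honest _) (l.map (layerRound K)) σ p = if p = 0 then 0 else
      (l.map fun t => Nat.card {g : Fin m // K.layer g = t}).sum * ℓ := by
  induction l generalizing σ with
  | nil => simp [bits]
  | cons t l ih =>
    rw [List.map_cons, List.map_cons, List.sum_cons, add_mul, bits]
    beta_reduce
    rw [ih, roundBits_honest]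
    have hb : bitLen ({g : Fin m // K.layer g = t} → ZMod (2 ^ ℓ)) = _ := bitLen_fun_zmod
    simp only [honestBits, layerRound, hb]
    fin_cases p <;> simp [Fin.sum_univ_three]

theorem costLe_deliverRound : CostLe (S := OnSt ℓ κ m I) [deliverRound] (m * ℓ) := by
  rw [show m * ℓ = (1 * (m * ℓ) + 0 * 0) + 0 by ring]
  refine .cons (fun σ => ?_) costLe_nil
  refine (sum_honestBits_le σ (fun p q => p = 1 ∧ q = 0) (fun _ => false)
    (b := m * ℓ) (b' := 0)
    (fun p q _ h => ⟨?_, (bitLen_fun_zmod.trans (by rw [Nat.card_fin])).le⟩)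
    (fun p h => absurd h (by simp [deliverRound]))).trans ?_
  · simpa using isSome_ite_none h
  · gcongr
    · decide
    · simp

theorem bits_deliverRound (σ : Srv → OnSt ℓ κ m I) (p : Srv) :
    bits (honest _) [deliverRound] σ p = if p = 1 then m * ℓ else 0 := by
  have hb : bitLen (Fin m → ZMod (2 ^ ℓ)) = m * ℓ := bitLen_fun_zmod.trans (by rw [Nat.card_fin])
  simp only [bits, roundBits_honest, honestBits, deliverRound, hb]
  fin_cases p <;> simp [Fin.sum_univ_three]

theorem costLe_online (hash : (Fin m → ZMod (2 ^ ℓ)) → Dig κ) :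
    CostLe (online (I := I) K hash) (m * (3 * ℓ) + 3 * (4 * κ + 25)) := by
  have h := (((((costLe_layers (ℓ := ℓ) (κ := κ) K (List.finRange T)).append costLe_deliverRound).append
    (costLe_jmpVerify (i := 1) (j := 2) (k := 0) (hash := hash) (val := toP₀) (get := OnSt.jmp)
      (put := fun s J => { s with jmp := J }))).append
    (costLe_jmpVerify (i := 1) (j := 0) (k := 2) (hash := hash) (val := toP₂ K) (get := OnSt.jmp)
      (put := fun s J => { s with jmp := J }))).append
    (costLe_jmpVerify (i := 2) (j := 0) (k := 1) (hash := hash) (val := toP₁ K) (get := OnSt.jmp)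
      (put := fun s J => { s with jmp := J })))
  refine fun A σ => (h A σ).trans (le_of_eq ?_)
  rw [sum_card_layer]
  ring

theorem length_online (hash : (Fin m → ZMod (2 ^ ℓ)) → Dig κ) :
    (online (I := I) K hash).length = T + 13 := by
  simp [online, jmpVerify]

/-- Values of `bg` matter only on the wires feeding the gate, so a server may still hold meaningless
values on later wires. -/
theorem starShare_congr {bg bg' a : Fin I ⊕ Fin m → ZMod (2 ^ ℓ)} {χ : Fin m → ZMod (2 ^ ℓ)}
    {g : Fin m} (hl : ∀ j, bg (K.left g j) = bg' (K.left g j))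
    (hr : ∀ j, bg (K.right g j) = bg' (K.right g j)) :
    starShare K bg a χ g = starShare K bg' a χ g := by
  simp only [starShare, hl, hr]

/-- A collection of states of the online phase in which nothing is missing. -/
def onState (mask : Srv → Fin I ⊕ Fin m → ZMod (2 ^ ℓ)) (F : Srv → Fin m → ZMod (2 ^ ℓ))
    (val : Srv → Fin I ⊕ Fin m → ZMod (2 ^ ℓ)) (s₁ s₂ : Srv → Fin m → ZMod (2 ^ ℓ))
    (J : Srv → Jmp κ) (p : Srv) : OnSt ℓ κ m I where
  maskLo := mask p
  maskHi := mask (p + 1)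
  fLo := F p
  fHi := F (p + 1)
  val := val p
  star₁ := s₁ p
  star₂ := s₂ p
  missing := false
  jmp := J p

section
variable (mask : Srv → Fin I ⊕ Fin m → ZMod (2 ^ ℓ)) (F : Srv → Fin m → ZMod (2 ^ ℓ))
  (v : Fin I ⊕ Fin m → ZMod (2 ^ ℓ))

/-- The masked value `β`. -/
def masked (w : Fin I ⊕ Fin m) : ZMod (2 ^ ℓ) := v w + (mask 0 w + mask 1 w)

/-- The correct shares of `β*`, where `s` is the number of the mask. -/
noncomputable def trueStar (s : Srv) : Fin m → ZMod (2 ^ ℓ) :=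
  starShare K (fun w => masked mask v w + mask 2 w) (mask s) (F s)

/-- The values held by the servers after `t` layers. -/
def valAfter (t : ℕ) (p : Srv) : Fin I ⊕ Fin m → ZMod (2 ^ ℓ) :=
  Sum.elim (fun x => if p = 0 then masked mask v (.inl x) + mask 2 (.inl x)
      else masked mask v (.inl x))
    fun g => if p ≠ 0 ∧ (K.layer g : ℕ) < t then masked mask v (.inr g) else 0

/-- The shares of `β*` held by the servers after `t` layers. -/
noncomputable def starAfter (s : Srv) (t : ℕ) (p : Srv) (g : Fin m) : ZMod (2 ^ ℓ) :=
  if p ≠ 0 ∧ (K.layer g : ℕ) < t then trueStar K mask F v s g else 0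

/-- The states after `t` layers. -/
noncomputable def layerState (t : ℕ) : Srv → OnSt ℓ κ m I :=
  onState mask F (valAfter K mask v t) (starAfter K mask F v 1 t) (starAfter K mask F v 0 t)
    fun _ => Jmp.start κ

variable {mask F v}

/-- Since `χ + ψ` equals the sum of `(γ + α)(γ + α) - γγ = αα + αγ + γα`, the products with `γ`
cancel against those in `β*`. What remains is the sum of `(β_x - α_x)(β_y - α_y)`, the output value,
plus its mask `α_z`. -/
theorem masked_gate (hv : K.Computes v) (hF : ∀ g, ∑ s, F s g =
      ∑ j, (∑ s, mask s (K.left g j)) * (∑ s, mask s (K.right g j))) (g : Fin m) :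
    (trueStar K mask F v 1 g + trueStar K mask F v 0 g) +
      (∑ j : Fin n, masked mask v (K.left g j) * masked mask v (K.right g j)) +
      (F 2 g - ∑ j : Fin n, mask 2 (K.left g j) * mask 2 (K.right g j)) = masked mask v (.inr g) := by
  have h := hF g
  simp only [Fin.sum_univ_three] at h
  have h2 : F 2 g = (∑ j, (mask 0 (K.left g j) + mask 1 (K.left g j) + mask 2 (K.left g j)) *
      (mask 0 (K.right g j) + mask 1 (K.right g j) + mask 2 (K.right g j))) - F 0 g - F 1 g := by
    rw [← h]; ring
  rw [h2]
  simp only [trueStar, starShare, masked]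
  rw [hv g]
  have key : -(∑ j, ((v (K.left g j) + (mask 0 (K.left g j) + mask 1 (K.left g j)) +
          mask 2 (K.left g j)) * mask 1 (K.right g j) + (v (K.right g j) + (mask 0 (K.right g j) +
          mask 1 (K.right g j)) + mask 2 (K.right g j)) * mask 1 (K.left g j))) -
        (∑ j, ((v (K.left g j) + (mask 0 (K.left g j) + mask 1 (K.left g j)) +
          mask 2 (K.left g j)) * mask 0 (K.right g j) + (v (K.right g j) + (mask 0 (K.right g j) +
          mask 1 (K.right g j)) + mask 2 (K.right g j)) * mask 0 (K.left g j))) +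
        (∑ j, (v (K.left g j) + (mask 0 (K.left g j) + mask 1 (K.left g j))) *
          (v (K.right g j) + (mask 0 (K.right g j) + mask 1 (K.right g j)))) +
        (∑ j, (mask 0 (K.left g j) + mask 1 (K.left g j) + mask 2 (K.left g j)) *
          (mask 0 (K.right g j) + mask 1 (K.right g j) + mask 2 (K.right g j))) -
        (∑ j, mask 2 (K.left g j) * mask 2 (K.right g j)) -
        (∑ j, v (K.left g j) * v (K.right g j)) = 0 := by
    simp only [← Finset.sum_neg_distrib, ← Finset.sum_sub_distrib, ← Finset.sum_add_distrib]
    exact Finset.sum_eq_zero fun j _ => by ring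
  linear_combination key

variable (mask F v)

theorem valAfter_of_layer_lt {t : ℕ} {p : Srv} (hp : p ≠ 0) {w : Fin I ⊕ Fin m}
    (hw : ∀ g, w = .inr g → (K.layer g : ℕ) < t) :
    valAfter K mask v t p w = masked mask v w := by
  rcases w with x | g
  · simp [valAfter, hp]
  · simp [valAfter, hp, hw g rfl]

theorem valAfter_left {t : Fin T} {p : Srv} (hp : p ≠ 0) {g : Fin m} (hg : K.layer g = t)
    (j : Fin n) : valAfter K mask v t p (K.left g j) = masked mask v (K.left g j) :=
  valAfter_of_layer_lt K mask v hp fun g' h => hg ▸ K.left_lt g j g' h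

theorem valAfter_right {t : Fin T} {p : Srv} (hp : p ≠ 0) {g : Fin m} (hg : K.layer g = t)
    (j : Fin n) : valAfter K mask v t p (K.right g j) = masked mask v (K.right g j) :=
  valAfter_of_layer_lt K mask v hp fun g' h => hg ▸ K.right_lt g j g' h

theorem star₁P₁_layerState {t : Fin T} {g : Fin m} (hg : K.layer g = t) :
    (layerState (κ := κ) K mask F v t 1).star₁P₁ K g = trueStar K mask F v 1 g :=
  starShare_congr K
    (fun j => congrArg (· + _) (valAfter_left K mask v (by decide) hg j))
    fun j => congrArg (· + _) (valAfter_right K mask v (by decide) hg j)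

theorem star₂P₂_layerState {t : Fin T} {g : Fin m} (hg : K.layer g = t) :
    (layerState (κ := κ) K mask F v t 2).star₂P₂ K g = trueStar K mask F v 0 g :=
  starShare_congr K
    (fun j => congrArg (· + _) (valAfter_left K mask v (by decide) hg j))
    fun j => congrArg (· + _) (valAfter_right K mask v (by decide) hg j)

variable {mask F v}

/-- This covers `P_1` and `P_2` at once: both know `mask 2` and `F 2`, and they differ only in which
share of `β*` is computed and which is received. -/
theorem absorb_layerState (hv : K.Computes v) (hF : ∀ g, ∑ s, F s g =
      ∑ j, (∑ s, mask s (K.left g j)) * (∑ s, mask s (K.right g j))) (t : Fin T) {p : Srv}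
    (hp : p ≠ 0) {a a' : Fin m → ZMod (2 ^ ℓ)}
    (ha : ∀ g, K.layer g = t → a g = trueStar K mask F v 1 g)
    (ha' : ∀ g, K.layer g = t → a' g = trueStar K mask F v 0 g) :
    { (layerState (κ := κ) K mask F v t p).absorb K t a a' (mask 2) (F 2) with missing := false } =
      layerState K mask F v (t + 1) p := by
  have hlt : ∀ g, (K.layer g : ℕ) < t + 1 ↔ K.layer g = t ∨ (K.layer g : ℕ) < t := by
    intro g
    rw [Fin.ext_iff]
    omega
  simp only [OnSt.absorb, layerState, onState, OnSt.mk.injEq, true_and, and_true]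
  refine ⟨?_, ?_, ?_⟩
  · funext w
    rcases w with x | g
    · rfl
    · simp only [Sum.elim_inr]
      by_cases hg : K.layer g = t
      · rw [if_pos hg, ha g hg, ha' g hg, valAfter_of_layer_lt K mask v hp]
        · simp only [valAfter_left K mask v hp hg, valAfter_right K mask v hp hg]
          exact masked_gate K hv hF g
        · rintro g' h
          obtain rfl := Sum.inr_injective h
          rw [hlt]
          exact Or.inl hg
      · simp [valAfter, hg, hlt, hp]
  · funext g
    by_cases hg : K.layer g = t
    · simp [starAfter, hg, ha g hg, hp]
    · simp [starAfter, hg, hlt, hp]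
  · funext g
    by_cases hg : K.layer g = t
    · simp [starAfter, hg, ha' g hg, hp]
    · simp [starAfter, hg, hlt, hp]

theorem layerRound_honest (hv : K.Computes v) (hF : ∀ g, ∑ s, F s g =
      ∑ j, (∑ s, mask s (K.left g j)) * (∑ s, mask s (K.right g j))) (t : Fin T) :
    honestStep (layerRound K t) (layerState (κ := κ) K mask F v t) =
      layerState K mask F v (t + 1) := by
  funext p
  fin_cases p
  · simp only [Fin.zero_eta]
    -- `P_0` is idle during the layers, and its values and shares in `layerState` do not depend on
    -- `t`.
    have h0 : ∀ t, layerState (κ := κ) K mask F v t 0 = layerState K mask F v 0 0 := by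
      intro t
      simp only [layerState, onState, OnSt.mk.injEq, true_and, and_true]
      refine ⟨?_, ?_, ?_⟩
      · simp [valAfter]
      · funext g; simp [starAfter]
      · funext g; simp [starAfter]
    rw [h0 (t + 1), ← h0 t]
    rfl
  · refine Eq.trans ?_ (absorb_layerState K hv hF t (p := 1) (by decide)
      (a := (layerState (κ := κ) K mask F v t 1).star₁P₁ K)
      (a' := ofLayer K t (some fun g => (layerState (κ := κ) K mask F v t 2).star₂P₂ K g))
      (fun g hg => star₁P₁_layerState K mask F v hg) fun g hg => ?_)
    · rfl
    · rw [← star₂P₂_layerState (κ := κ) K mask F v hg, ofLayer, dif_pos hg]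
      rfl
  · refine Eq.trans ?_ (absorb_layerState K hv hF t (p := 2) (by decide)
      (a := ofLayer K t (some fun g => (layerState (κ := κ) K mask F v t 1).star₁P₁ K g))
      (a' := (layerState (κ := κ) K mask F v t 2).star₂P₂ K)
      (fun g hg => ?_) fun g hg => star₂P₂_layerState K mask F v hg)
    · rfl
    · rw [← star₁P₁_layerState (κ := κ) K mask F v hg, ofLayer, dif_pos hg]
      rfl

theorem run_layers (hv : K.Computes v) (hF : ∀ g, ∑ s, F s g =
      ∑ j, (∑ s, mask s (K.left g j)) * (∑ s, mask s (K.right g j))) {t : ℕ} (ht : t ≤ T) :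
    run (honest _) (((List.finRange T).map (layerRound K)).take t)
      (layerState (κ := κ) K mask F v 0) = layerState K mask F v t := by
  induction t with
  | zero => rfl
  | succ t ih =>
    have hlen : t < ((List.finRange T).map (layerRound (ℓ := ℓ) (κ := κ) K)).length := by
      simpa using ht
    rw [← List.take_concat_get' _ _ hlen, run_honest_append, ih (by omega)]
    simp only [List.getElem_map, List.getElem_finRange, run, step_honest]
    exact layerRound_honest K hv hF ⟨t, ht⟩

variable (mask v) in
/-- The values that the servers hold at the end. -/
def finalVal (p : Srv) (w : Fin I ⊕ Fin m) : ZMod (2 ^ ℓ) :=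
  if p = 0 then masked mask v w + mask 2 w else masked mask v w

variable (mask F v) in
/-- The states after the values are delivered to `P_0`. -/
noncomputable def deliveredState : (Srv → Jmp κ) → Srv → OnSt ℓ κ m I :=
  onState mask F (finalVal mask v) (starAfter K mask F v 1 T) (starAfter K mask F v 0 T)

theorem valAfter_last {p : Srv} (hp : p ≠ 0) : valAfter K mask v T p = finalVal mask v p := by
  funext w
  rw [valAfter_of_layer_lt K mask v hp fun g _ => (K.layer g).2, finalVal, if_neg hp]

theorem starAfter_last (s : Srv) {p : Srv} (hp : p ≠ 0) :
    starAfter K mask F v s T p = trueStar K mask F v s := by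
  funext g
  simp [starAfter, hp]

theorem deliverRound_honest :
    honestStep deliverRound (layerState (κ := κ) K mask F v T) =
      deliveredState K mask F v fun _ => Jmp.start κ := by
  funext p
  fin_cases p
  · simp only [honestStep, layerState, deliveredState, onState, deliverRound, Fin.zero_eta, if_true,
      OnSt.mk.injEq, true_and, and_true, Option.getD_some, Option.isNone_some]
    funext w
    rcases w with x | g
    · rfl
    · exact congrArg (· + mask 2 (.inr g)) (congrFun (valAfter_last K (p := 1) (by decide)) (.inr g))
  · change layerState K mask F v T 1 = deliveredState K mask F v (fun _ => Jmp.start κ) 1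
    simp only [layerState, deliveredState, onState, OnSt.mk.injEq, true_and, and_true]
    exact valAfter_last K (p := 1) (by decide)
  · change layerState K mask F v T 2 = deliveredState K mask F v (fun _ => Jmp.start κ) 2
    simp only [layerState, deliveredState, onState, OnSt.mk.injEq, true_and, and_true]
    exact valAfter_last K (p := 2) (by decide)

theorem toP₀_delivered (J : Srv → Jmp κ) (p : Srv) : toP₀ p (deliveredState K mask F v J p) =
    some fun g => masked mask v (.inr g) + mask 2 (.inr g) := by
  fin_cases p <;> rfl

/-- `P_0` recomputes the shares of `β*` from the values `β + γ`, which reach it only after the last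
layer; one verify phase then covers all layers. -/
theorem toP₂_delivered (J : Srv → Jmp κ) (p : Srv) : toP₂ K p (deliveredState K mask F v J p) =
    some (trueStar K mask F v 1) := by
  fin_cases p
  · rfl
  · exact congrArg some (starAfter_last K 1 (by decide))
  · exact congrArg some (starAfter_last K 1 (by decide))

theorem toP₁_delivered (J : Srv → Jmp κ) (p : Srv) : toP₁ K p (deliveredState K mask F v J p) =
    some (trueStar K mask F v 0) := by
  fin_cases p
  · rfl
  · exact congrArg some (starAfter_last K 0 (by decide))
  · exact congrArg some (starAfter_last K 0 (by decide))

theorem OnSt.jmpAccess {val : Srv → OnSt ℓ κ m I → Option (Fin m → ZMod (2 ^ ℓ))}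
    (h : ∀ p s J, val p { s with jmp := J } = val p s) :
    JmpAccess val OnSt.jmp (fun s J => { s with jmp := J }) where
  get_put _ _ := rfl
  put_put _ _ _ := rfl
  val_put := h

/-- The verify phases of the online phase find no inconsistency. -/
theorem run_online_verify (hash : (Fin m → ZMod (2 ^ ℓ)) → Dig κ) :
    ∃ J J' J'' : Srv → Jmp κ, (∀ p, (J p).ttp = none) ∧ (∀ p, (J' p).ttp = none) ∧
      (∀ p, (J'' p).ttp = none) ∧
      run (honest _) (jmpVerify 1 2 0 hash toP₀ OnSt.jmp (fun s J => { s with jmp := J }))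
        (deliveredState K mask F v fun _ => Jmp.start κ) = deliveredState K mask F v J ∧
      run (honest _) (jmpVerify 1 0 2 hash (toP₂ K) OnSt.jmp (fun s J => { s with jmp := J }))
        (deliveredState K mask F v J) = deliveredState K mask F v J' ∧
      run (honest _) (jmpVerify 2 0 1 hash (toP₁ K) OnSt.jmp (fun s J => { s with jmp := J }))
        (deliveredState K mask F v J') = deliveredState K mask F v J'' := by
  obtain ⟨J, h, e⟩ := jmpVerify_run (i := 1) (j := 2) (k := 0) (hash := hash) (by decide)
    (by decide) (by decide) (OnSt.jmpAccess fun _ _ _ => rfl) (fun _ => rfl)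
    (toP₀_delivered K (mask := mask) (F := F) (v := v) fun _ => Jmp.start κ)
  obtain ⟨J', h', e'⟩ := jmpVerify_run (i := 1) (j := 0) (k := 2) (hash := hash) (by decide)
    (by decide) (by decide) (OnSt.jmpAccess fun _ _ _ => rfl) h
    (toP₂_delivered K (mask := mask) (F := F) (v := v) J)
  obtain ⟨J'', h'', e''⟩ := jmpVerify_run (i := 2) (j := 0) (k := 1) (hash := hash) (by decide)
    (by decide) (by decide) (OnSt.jmpAccess fun _ _ _ => rfl) h'
    (toP₁_delivered K (mask := mask) (F := F) (v := v) J')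
  exact ⟨J, J', J'', h, h', h'', e, e', e''⟩

theorem run_layers_all (hv : K.Computes v) (hF : ∀ g, ∑ s, F s g =
      ∑ j, (∑ s, mask s (K.left g j)) * (∑ s, mask s (K.right g j))) :
    run (honest _) ((List.finRange T).map (layerRound K) ++ [deliverRound])
      (layerState (κ := κ) K mask F v 0) = deliveredState K mask F v fun _ => Jmp.start κ := by
  have h := run_layers (κ := κ) K hv hF le_rfl
  rw [List.take_of_length_le (by simp)] at h
  rw [run_honest_append, h, ← deliverRound_honest]
  rfl

theorem run_online (hv : K.Computes v) (hF : ∀ g, ∑ s, F s g =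
      ∑ j, (∑ s, mask s (K.left g j)) * (∑ s, mask s (K.right g j)))
    (hash : (Fin m → ZMod (2 ^ ℓ)) → Dig κ) : ∃ J : Srv → Jmp κ, (∀ p, (J p).ttp = none) ∧
      run (honest _) (online K hash) (layerState K mask F v 0) = deliveredState K mask F v J := by
  obtain ⟨J, J', J'', -, -, h, e, e', e''⟩ := run_online_verify K (mask := mask) (F := F) (v := v) hash
  refine ⟨J'', h, ?_⟩
  rw [online, run_honest_append, run_honest_append, run_honest_append, run_layers_all K hv hF, e, e',
    e'']

theorem totalBits_online (hv : K.Computes v) (hF : ∀ g, ∑ s, F s g =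
      ∑ j, (∑ s, mask s (K.left g j)) * (∑ s, mask s (K.right g j)))
    (hash : (Fin m → ZMod (2 ^ ℓ)) → Dig κ) :
    totalBits (honest _) (online K hash) (layerState K mask F v 0) =
      m * (3 * ℓ) + 3 * (κ + 4) := by
  obtain ⟨J, J', -, h, h', -, e, e', -⟩ := run_online_verify K (mask := mask) (F := F) (v := v) hash
  have b := jmpVerify_bits (i := 1) (j := 2) (k := 0) (hash := hash) (by decide)
    (by decide) (by decide) (OnSt.jmpAccess fun _ _ _ => rfl) (fun _ => rfl)
    (toP₀_delivered K (mask := mask) (F := F) (v := v) fun _ => Jmp.start κ)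
  have b' := jmpVerify_bits (i := 1) (j := 0) (k := 2) (hash := hash) (by decide)
    (by decide) (by decide) (OnSt.jmpAccess fun _ _ _ => rfl) h
    (toP₂_delivered K (mask := mask) (F := F) (v := v) J)
  have b'' := jmpVerify_bits (i := 2) (j := 0) (k := 1) (hash := hash) (by decide)
    (by decide) (by decide) (OnSt.jmpAccess fun _ _ _ => rfl) h'
    (toP₁_delivered K (mask := mask) (F := F) (v := v) J')
  simp only [totalBits, online, bits_honest_append]
  rw [run_honest_append _ (jmpVerify 1 0 2 _ _ _ _), run_honest_append _ (jmpVerify 1 2 0 _ _ _ _),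
    run_layers_all K hv hF, e, e']
  simp only [b, b', b'', bits_layers, bits_deliverRound, sum_card_layer, Fin.sum_univ_three]
  simp
  ring

theorem shared_delivered (J : Srv → Jmp κ) : Shared mask (deliveredState K mask F v J) v :=
  ⟨fun _ => ⟨rfl, rfl⟩, fun _ => ⟨rfl, rfl, rfl⟩⟩

/-- For `t ≤ T` the first `t` rounds are layer rounds only, so the state is `layerState` at `t`. -/
theorem val_take_online (hv : K.Computes v) (hF : ∀ g, ∑ s, F s g =
      ∑ j, (∑ s, mask s (K.left g j)) * (∑ s, mask s (K.right g j)))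
    (hash : (Fin m → ZMod (2 ^ ℓ)) → Dig κ) {t : ℕ} (ht : t ≤ T) {g : Fin m}
    (hg : (K.layer g : ℕ) < t) {p : Srv} (hp : p ≠ 0) :
    (run (honest _) ((online K hash).take t) (layerState K mask F v 0) p).val (.inr g) =
      masked mask v (.inr g) := by
  have h : (online (κ := κ) K hash).take t =
      ((List.finRange T).map (layerRound (ℓ := ℓ) (κ := κ) K)).take t := by
    simp only [online, List.append_assoc]
    exact List.take_append_of_le_length (by simpa using ht)
  rw [h, run_layers K hv hF ht]
  change valAfter K mask v t p (.inr g) = _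
  refine valAfter_of_layer_lt K mask v hp ?_
  rintro g' h'
  obtain rfl := Sum.inr_injective h'
  exact hg

end
end

/-- The online phase starts in the states before the first layer. -/
theorem onInit_eq {P : Par} {T I : ℕ} (K : DotCircuit P.n P.m T I)
    (mask : Srv → Fin I ⊕ Fin P.m → P.Z) (v : Fin I ⊕ Fin P.m → P.Z) (F : Srv → Fin P.m → P.Z)
    (σ : Srv → PreSt P) (h : ∀ p, (σ p).fLo = F p ∧ (σ p).fHi = F (p + 1)) :
    onInit mask (fun x => v (.inl x) + (mask 0 (.inl x) + mask 1 (.inl x))) σ =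
      layerState K mask F v 0 := by
  funext p
  simp only [onInit, layerState, onState, OnSt.mk.injEq, true_and, and_true, (h p).1, (h p).2]
  refine ⟨?_, ?_, ?_⟩
  · funext w
    rcases w with x | g
    · rfl
    · simp [valAfter]
  · funext g
    simp [starAfter]
  · funext g
    simp [starAfter]


/-! ### Choice of parameters and asymptotics -/

theorem exists_monic_irreducible_mod_two (d : ℕ) : ∃ f : ℤ[X], f.Monic ∧ f.natDegree = d + 1 ∧
    Irreducible (f.map (Int.castRingHom (ZMod 2))) := by
  -- The minimal polynomial of a primitive element of the field with `2 ^ (d + 1)` elements has the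
  -- right degree; it is lifted to a monic integer polynomial.
  obtain ⟨α, hα⟩ := Field.exists_primitive_element_of_finite_top (ZMod 2) (GaloisField 2 (d + 1))
  have hint : IsIntegral (ZMod 2) α := Algebra.IsIntegral.isIntegral α
  have hdeg := (Field.primitive_element_iff_minpoly_natDegree_eq (ZMod 2) α).1 hα
  rw [GaloisField.finrank 2 d.succ_ne_zero] at hdeg
  have hl : minpoly (ZMod 2) α ∈ lifts (Int.castRingHom (ZMod 2)) := by
    rw [lifts_iff_coeff_lifts]
    exact fun i => ZMod.ringHom_surjective _ _
  obtain ⟨f, hf, hfd, hfm⟩ := lifts_and_natDegree_eq_and_monic hl (minpoly.monic hint)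
  exact ⟨f, hfm, hfd.trans hdeg, hf ▸ minpoly.irreducible hint⟩

theorem sqrt_mul_bounds {n m : ℕ} (hn : 1 ≤ n) (hm : 1 ≤ m) :
    (1 : ℝ) ≤ √((n : ℝ) * m) ∧ √((n : ℝ) * m) * √((n : ℝ) * m) = n * m := by
  have hn' : (1 : ℝ) ≤ n := by exact_mod_cast hn
  have hm' : (1 : ℝ) ≤ m := by exact_mod_cast hm
  exact ⟨Real.one_le_sqrt.2 (by nlinarith), Real.mul_self_sqrt (by positivity)⟩

theorem exists_group_size {n m : ℕ} (hn : 1 ≤ n) (hm : 1 ≤ m) (hnm : n ≤ m) :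
    ∃ L M : ℕ, m ≤ L * M ∧
      3 * (((4 * n + 2) * L + 2 * M + 3 : ℕ) : ℝ) ≤ 57 * √((n : ℝ) * m) := by
  obtain ⟨h1, hs⟩ := sqrt_mul_bounds hn hm
  set s := √((n : ℝ) * m) with hsdef
  have hn' : (1 : ℝ) ≤ n := by exact_mod_cast hn
  have hnm' : (n : ℝ) ≤ m := by exact_mod_cast hnm
  have hns : (n : ℝ) ≤ s := Real.le_sqrt_of_sq_le (by nlinarith)
  have hL : (⌈s / n⌉₊ : ℝ) ≤ s / n + 1 := (Nat.ceil_lt_add_one (by positivity)).le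
  have hM : (⌈s⌉₊ : ℝ) ≤ s + 1 := (Nat.ceil_lt_add_one (by positivity)).le
  have hdiv : (n : ℝ) * (s / n) = s := by field_simp
  -- With `s = √(nm)` the product is at least `s² / n = m`. As `n ≤ s`, the three summands are at
  -- most `6nL ≤ 12s`, `2M ≤ 4s` and `3s`, which gives `3 * 19 = 57`.
  refine ⟨⌈s / n⌉₊, ⌈s⌉₊, ?_, ?_⟩
  · have h : (m : ℝ) ≤ ⌈s / n⌉₊ * ⌈s⌉₊ := by
      calc (m : ℝ) = s / n * s := by
            rw [div_mul_eq_mul_div, hs]; field_simp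
        _ ≤ _ := by
          gcongr
          · exact Nat.le_ceil _
          · exact Nat.le_ceil _
    exact_mod_cast h
  · push_cast
    have : (n : ℝ) * ⌈s / n⌉₊ ≤ s + n := by
      calc (n : ℝ) * ⌈s / n⌉₊ ≤ n * (s / n + 1) := by gcongr
        _ = s + n := by rw [mul_add, hdiv, mul_one]
    have hL0 : (0 : ℝ) ≤ ⌈s / n⌉₊ := Nat.cast_nonneg _
    have : (⌈s / n⌉₊ : ℝ) ≤ n * ⌈s / n⌉₊ := le_mul_of_one_le_left hL0 hn'
    nlinarith

theorem cost_of_balanced {n m L M : ℕ} (hn : 1 ≤ n) (hm : 1 ≤ m) (hLM : (4 * n + 2) * L = 2 * M)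
    (h : m = L * M) :
    3 * (((4 * n + 2) * L + 2 * M + 3 : ℕ) : ℝ) ≤ 57 * √((n : ℝ) * m) := by
  obtain ⟨h1, hs⟩ := sqrt_mul_bounds hn hm
  set s := √((n : ℝ) * m) with hsdef
  have hn' : (1 : ℝ) ≤ n := by exact_mod_cast hn
  have hm' : (1 : ℝ) ≤ m := by exact_mod_cast hm
  have hM : (M : ℝ) = (2 * n + 1) * L := by
    have : (((4 * n + 2) * L : ℕ) : ℝ) = (2 * M : ℕ) := by rw [hLM]
    push_cast at this
    linarith
  have hm2 : (m : ℝ) = L * M := by exact_mod_cast h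
  have hMs : (M : ℝ) ≤ 2 * s := by
    refine abs_le_of_sq_le_sq' ?_ (by positivity) |>.2
    -- Balance means `M = (2n + 1) L`, so `M² = (2n + 1) L M`, which is at most `4nm`.
    have : (M : ℝ) ^ 2 = (2 * n + 1) * m := by
      rw [hm2, sq]
      nth_rw 1 [hM]
      ring
    nlinarith
  rw [hLM]
  push_cast
  nlinarith

/-- With `A = 2^((ℓ-1)d)`, `G = 2^γ`, `D = 2^d` the ratio is `(1 + 1/(AG)) / (1 - M/(AD))`. Both
corrections tend to zero because `A ≥ 1`, `G → ∞`, `M ≤ G` and `G/D → 0`. -/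
theorem tendsto_errBound_ratio {ℓ : ℕ} (hℓ : 1 ≤ ℓ) {M γ d : ℕ → ℕ} (hM : ∀ i, 2 * M i ≤ 2 ^ γ i)
    (hγ : Tendsto γ atTop atTop) (hd : Tendsto (fun i => (d i : ℝ) - γ i) atTop atTop) :
    Tendsto (fun i => errBound ℓ (d i) (M i) (2 ^ γ i) / (2 : ℝ) ^ (-((d i : ℝ) - γ i)))
      atTop (𝓝 1) := by
  have hrpow : ∀ i, (2 : ℝ) ^ (-((d i : ℝ) - γ i)) = 2 ^ γ i / 2 ^ d i := by
    intro i
    rw [neg_sub, Real.rpow_sub (by norm_num), Real.rpow_natCast, Real.rpow_natCast]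
  have hpow : ∀ i, (2 : ℝ) ^ (ℓ * d i) = 2 ^ ((ℓ - 1) * d i) * 2 ^ d i := by
    intro i
    rw [← pow_add]
    congr 1
    obtain ⟨l, rfl⟩ : ∃ l, ℓ = l + 1 := ⟨ℓ - 1, by omega⟩
    simp only [Nat.add_sub_cancel]
    ring
  have hA : ∀ i, (1 : ℝ) ≤ 2 ^ ((ℓ - 1) * d i) := fun i => one_le_pow₀ (by norm_num)
  have heq : ∀ i, errBound ℓ (d i) (M i) (2 ^ γ i) / (2 : ℝ) ^ (-((d i : ℝ) - γ i)) =
      (1 + (2 ^ ((ℓ - 1) * d i) * 2 ^ γ i : ℝ)⁻¹) /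
        (1 - M i / (2 ^ ((ℓ - 1) * d i) * 2 ^ d i)) := by
    intro i
    rw [hrpow, errBound, hpow]
    have hA := hA i
    have hG : (0 : ℝ) < 2 ^ γ i := by positivity
    have hD : (0 : ℝ) < 2 ^ d i := by positivity
    generalize (2 : ℝ) ^ ((ℓ - 1) * d i) = A at *
    generalize (2 : ℝ) ^ γ i = G at *
    generalize (2 : ℝ) ^ d i = D at *
    have hA0 : 0 < A := by linarith
    have e1 : 1 - (M i : ℝ) / (A * D) = (A * D - M i) / (A * D) := by field_simp
    have e2 : 1 + (A * G)⁻¹ = (A * G + 1) / (A * G) := by field_simp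
    rw [e1, e2]
    -- Where the denominator vanishes both sides are `0` by convention, so the identity needs no
    -- validity assumption.
    by_cases h0 : A * D - (M i : ℝ) = 0
    · rw [h0]; simp
    · field_simp
  have h1 : Tendsto (fun i => (2 ^ ((ℓ - 1) * d i) * 2 ^ γ i : ℝ)⁻¹) atTop (𝓝 0) := by
    have hp : Tendsto (fun i => ((2 : ℝ) ^ γ i)⁻¹) atTop (𝓝 0) :=
      ((tendsto_pow_atTop_atTop_of_one_lt (by norm_num : (1 : ℝ) < 2)).comp hγ).inv_tendsto_atTop
    refine squeeze_zero (fun i => by positivity) (fun i => ?_) hp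
    exact inv_anti₀ (by positivity) (le_mul_of_one_le_left (by positivity) (hA i))
  have h2 : Tendsto (fun i => (M i : ℝ) / (2 ^ ((ℓ - 1) * d i) * 2 ^ d i)) atTop (𝓝 0) := by
    have hp : Tendsto (fun i => (2 : ℝ) ^ (-((d i : ℝ) - γ i))) atTop (𝓝 0) := by
      have hp := (tendsto_rpow_atTop_of_base_lt_one (2 : ℝ)⁻¹ (by norm_num) (by norm_num)).comp hd
      refine hp.congr fun i => ?_
      simp only [Function.comp]
      rw [Real.inv_rpow (by norm_num), Real.rpow_neg (by norm_num)]
    refine squeeze_zero (fun i => by positivity) (fun i => ?_) hp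
    rw [hrpow]
    have hMi : (M i : ℝ) ≤ 2 ^ γ i := by
      have : M i ≤ 2 ^ γ i := by have := hM i; omega
      exact_mod_cast this
    gcongr
    exact le_mul_of_one_le_left (by positivity) (hA i)
  simp_rw [heq]
  have h := (h1.const_add 1).div (h2.const_sub 1) (by norm_num)
  rwa [add_zero, sub_zero, div_one] at h

theorem tendsto_inv_add_errBound_ratio {ℓ : ℕ} (hℓ : 1 ≤ ℓ) {M γ d : ℕ → ℕ}
    (hM : ∀ i, 2 * M i ≤ 2 ^ γ i) (hγ : Tendsto γ atTop atTop)
    (hd : Tendsto (fun i => (d i : ℝ) - γ i) atTop atTop) :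
    Tendsto (fun i => (((2 : ℝ) ^ d i)⁻¹ + errBound ℓ (d i) (M i) (2 ^ γ i)) /
      (2 : ℝ) ^ (-((d i : ℝ) - γ i))) atTop (𝓝 1) := by
  have hp : Tendsto (fun i => ((2 : ℝ) ^ γ i)⁻¹) atTop (𝓝 0) :=
    ((tendsto_pow_atTop_atTop_of_one_lt (by norm_num : (1 : ℝ) < 2)).comp hγ).inv_tendsto_atTop
  have h := hp.add (tendsto_errBound_ratio hℓ hM hγ hd)
  rw [zero_add] at h
  refine h.congr fun i => ?_
  rw [add_div]
  congr 1
  rw [neg_sub, Real.rpow_sub (by norm_num), Real.rpow_natCast, Real.rpow_natCast]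
  field_simp

theorem amortizes_add {g : ℕ → ℕ} (c : ℕ) (hg : Tendsto (fun m : ℕ => (g m : ℝ) / m) atTop (𝓝 0)) :
    Amortizes (fun m => m * c + g m) c := by
  have h := hg.const_add (c : ℝ)
  rw [add_zero] at h
  refine h.congr' ?_
  filter_upwards [eventually_ne_atTop 0] with m hm
  have : (m : ℝ) ≠ 0 := by exact_mod_cast hm
  push_cast
  field_simp

theorem amortizes_add_const (c b : ℕ) : Amortizes (fun m => m * c + b) c :=
  amortizes_add c (tendsto_const_div_atTop_nhds_zero_nat (b : ℝ))

/-- The degree of the extension used for `m` dot products. -/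
def extDegree (sec m : ℕ) : ℕ := sec + 4 + Nat.log 2 m + 1

/-- The number of groups of `m` dot products. -/
def groupCount (m : ℕ) : ℕ := Nat.sqrt m + 1

theorem groupCount_le (sec m : ℕ) : 8 * groupCount m * 2 ^ sec ≤ 2 ^ extDegree sec m := by
  have h := Nat.lt_pow_succ_log_self (b := 2) (by norm_num) m
  have h' := Nat.sqrt_le_self m
  have e : 2 ^ extDegree sec m = 2 ^ sec * (16 * 2 ^ (Nat.log 2 m + 1)) := by
    rw [extDegree]; ring
  rw [e, mul_comm]
  refine Nat.mul_le_mul_left _ ?_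
  unfold groupCount
  omega

/-- The number of ring elements is `O(√m)` and each costs `O(log m)` bits, while `log m / √m → 0`.
-/
theorem tendsto_verification_cost (u ℓ sec b : ℕ) : Tendsto (fun m : ℕ =>
    ((3 * (u * groupCount m + 2 * groupCount m + 3) * (ℓ * extDegree sec m) + b : ℕ) : ℝ) / m)
    atTop (𝓝 0) := by
  have h1 : Tendsto (fun m : ℕ => Real.log m / √(m : ℝ)) atTop (𝓝 0) := by
    have h := (isLittleO_log_rpow_atTop (r := 1 / 2) (by norm_num)).tendsto_div_nhds_zero
    simp_rw [← Real.sqrt_eq_rpow] at h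
    exact h.comp tendsto_natCast_atTop_atTop
  have h3 : Tendsto (fun m : ℕ => 1 / √(m : ℝ)) atTop (𝓝 0) := by
    simp_rw [one_div]
    exact (Real.tendsto_sqrt_atTop.comp tendsto_natCast_atTop_atTop).inv_tendsto_atTop
  have h2 : Tendsto (fun m : ℕ => (b : ℝ) / m) atTop (𝓝 0) :=
    tendsto_const_div_atTop_nhds_zero_nat _
  have h := ((h1.const_mul (6 * (u + 5) * ℓ * 2 : ℝ)).add
    (h3.const_mul (6 * (u + 5) * ℓ * (sec + 5) : ℝ))).add h2
  simp only [mul_zero, add_zero] at h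
  refine squeeze_zero' (Eventually.of_forall fun m => by positivity) ?_ h
  filter_upwards [eventually_ge_atTop 1] with m hm
  have hm' : (1 : ℝ) ≤ m := by exact_mod_cast hm
  have hs1 : (1 : ℝ) ≤ √(m : ℝ) := Real.one_le_sqrt.2 hm'
  have hG : (groupCount m : ℝ) ≤ 2 * √(m : ℝ) := by
    have := Real.nat_sqrt_le_real_sqrt (a := m)
    rw [groupCount]
    push_cast
    linarith
  have hG1 : (1 : ℝ) ≤ groupCount m := by
    rw [groupCount]; push_cast
    linarith [Nat.cast_nonneg (α := ℝ) (Nat.sqrt m)]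
  have hlog0 : 0 ≤ Real.log m := Real.log_nonneg hm'
  have hlog : (Nat.log 2 m : ℝ) ≤ 2 * Real.log m := by
    refine (Real.natLog_le_logb m 2).trans ?_
    rw [Real.logb, div_le_iff₀ (Real.log_pos (by norm_num))]
    have := Real.log_two_gt_d9
    push_cast
    nlinarith
  have hd : (extDegree sec m : ℝ) ≤ 2 * Real.log m + (sec + 5) := by
    rw [extDegree]; push_cast
    linarith
  have hu : (u * groupCount m + 2 * groupCount m + 3 : ℝ) ≤ (u + 5) * (2 * √(m : ℝ)) := by
    calc (u * groupCount m + 2 * groupCount m + 3 : ℝ) ≤ (u + 5) * groupCount m := by nlinarith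
      _ ≤ _ := by gcongr
  push_cast
  rw [add_div]
  refine add_le_add ?_ le_rfl
  rw [div_le_iff₀ (by positivity)]
  have hsq : √(m : ℝ) * √(m : ℝ) = m := Real.mul_self_sqrt (by positivity)
  calc (3 * (u * groupCount m + 2 * groupCount m + 3) * (ℓ * extDegree sec m) : ℝ)
      ≤ 3 * ((u + 5) * (2 * √(m : ℝ))) * (ℓ * (2 * Real.log m + (sec + 5))) := by gcongr
    _ = (6 * (u + 5) * ℓ * 2 * (Real.log m / √(m : ℝ)) +
          6 * (u + 5) * ℓ * (sec + 5) * (1 / √(m : ℝ))) * (√(m : ℝ) * √(m : ℝ)) := by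
        field_simp
        ring
    _ = _ := by rw [hsq]

theorem Par.Valid.inv_add_errBound_le {P : Par} (hP : P.Valid) {sec : ℕ} (hM : 1 ≤ P.M)
    (h : 8 * P.M * 2 ^ sec ≤ 2 ^ P.d) :
    ((2 : ℝ) ^ P.d)⁻¹ + errBound P.ℓ P.d P.M (2 * P.M) ≤ ((2 : ℝ) ^ sec)⁻¹ := by
  have hden := hP.errBound_denom_pos
  have hM' : (1 : ℝ) ≤ P.M := by exact_mod_cast hM
  have h' : 8 * (P.M : ℝ) * 2 ^ sec ≤ 2 ^ P.d := by exact_mod_cast h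
  have hA : (1 : ℝ) ≤ 2 ^ ((P.ℓ - 1) * P.d) := one_le_pow₀ (by norm_num)
  have hS : (1 : ℝ) ≤ 2 ^ sec := one_le_pow₀ (by norm_num)
  have hD : (0 : ℝ) < 2 ^ P.d := by positivity
  rw [hP.two_pow_mul_d] at hden
  rw [errBound, hP.two_pow_mul_d]
  generalize (2 : ℝ) ^ ((P.ℓ - 1) * P.d) = A at *
  generalize (2 : ℝ) ^ P.d = D at *
  generalize (2 : ℝ) ^ sec = S at *
  generalize (P.M : ℝ) = M at *
  have hMD : 8 * M ≤ D := (le_mul_of_one_le_right (by linarith) hS).trans h'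
  have hAD : D ≤ A * D := le_mul_of_one_le_left hD.le hA
  have h1 : (A * (2 * M) + 1) / (A * D - M) ≤ 6 * M / D := by
    rw [div_le_div_iff₀ hden hD]
    -- The numerator of the error is at most `3AM` since `A, M ≥ 1`, and the denominator is at least
    -- `AD / 2` since `8M ≤ D ≤ AD`; this gives `6M / D`.
    have : (A * (2 * M) + 1) * D ≤ 3 * M * (A * D) := by nlinarith
    nlinarith
  calc D⁻¹ + (A * (2 * M) + 1) / (A * D - M) ≤ 1 / D + 6 * M / D := by
        rw [one_div]; gcongr
    _ = (1 + 6 * M) / D := by rw [add_div]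
    _ ≤ 8 * M / D := by gcongr; linarith
    _ ≤ S⁻¹ := by
        rw [div_le_iff₀ hD, inv_mul_eq_div, le_div_iff₀ (by linarith)]
        exact h'

theorem exists_amortized_parameters (ℓ κ n sec : ℕ) (hℓ : 1 ≤ ℓ) : ∃ P : ℕ → Par,
    (∀ m, 1 ≤ m → (P m).Valid ∧ (P m).ℓ = ℓ ∧ (P m).κ = κ ∧ (P m).n = n ∧ (P m).m = m ∧
      ∀ x x' b b' c c', Cheats (P m) x x' →
        cheatProb (P m) x x' b b' c c' ≤ ((2 : ℝ) ^ sec)⁻¹) ∧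
    ∃ total worst : ℕ → ℕ, Amortizes total (3 * ℓ) ∧ Amortizes worst (3 * ℓ) ∧
      ∀ m, 1 ≤ m → ∀ hash : VMsg (P m) → Dig (P m).κ,
        (∀ dv ev τ, totalBits (honest _) (dotPPre hash) (preInit dv ev τ) = total m) ∧
        ∀ A σ', totalBits A (dotPPre hash) σ' ≤ worst m := by
  choose f hfm hfd hfi using exists_monic_irreducible_mod_two
  -- For fixed `n` a square arrangement is good enough. The polynomial `f e` has degree `e + 1`, so
  -- its index is one less than `extDegree`.
  let P : ℕ → Par := fun m => ⟨ℓ, κ, n, m, groupCount m, groupCount m, f (sec + 4 + Nat.log 2 m)⟩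
  have hd : ∀ m, (P m).d = extDegree sec m := fun m => hfd _
  have hle : ∀ m, 8 * (P m).M * 2 ^ sec ≤ 2 ^ (P m).d := fun m => by
    rw [hd]
    exact groupCount_le sec m
  have hM : ∀ m, 1 ≤ (P m).M := fun m => Nat.succ_le_succ (Nat.zero_le _)
  have hV : ∀ m, (P m).Valid := fun m =>
    { ring := hℓ
      monic := hfm _
      irred := hfi _
      groups := (Nat.lt_succ_sqrt m).le
      points := by
        have h1 := hle m
        have h2 := hM m
        have h3 : 1 ≤ 2 ^ sec := Nat.one_le_two_pow
        nlinarith }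
  have hc := fun b => amortizes_add (3 * ℓ) (tendsto_verification_cost (4 * n + 2) ℓ sec b)
  push_cast at hc
  refine ⟨P, fun m _ => ⟨hV m, rfl, rfl, rfl, rfl, fun x x' b b' c c' h => ?_⟩,
    _, _, hc (3 * (κ + 4)), hc (3 * (4 * κ + 25)), fun m _ hash => ⟨fun dv ev τ => ?_, fun A σ' => ?_⟩⟩
  · exact ((hV m).cheatProb_le x x' b b' h c c').trans ((hV m).inv_add_errBound_le (hM m) (hle m))
  · rw [totalBits_dotPPre dv ev τ (hV m), hd, add_assoc]
  · refine ((hV m).costLe_dotPPre hash A σ').trans (le_of_eq ?_)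
    rw [hd, add_assoc]

end DotP3

/-! ### Assembly of the claims -/

theorem mainTheorem5 :
    -- Preprocessing: semi-honest dot products followed by the verification of `m` tuples.
    (∀ P : Par, P.Valid →
      bitLen P.Z = P.ℓ ∧ bitLen P.E = P.ℓ * P.d ∧
      ∀ (hash : VMsg P → Dig P.κ) (dv ev : Srv → Fin P.m → Fin P.n → P.Z) (τ : Tape P),
        let σ₀ := preInit dv ev τ
        let σ₁ := run (honest _) [semiHonest] σ₀
        let σ := run (honest _) (dotPPre hash) σ₀
        (∀ p, bits (honest _) [semiHonest] σ₀ p = P.m * P.ℓ) ∧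
        (∀ p, bits (honest _) (verification hash) σ₁ p =
          (P.u * P.L + 2 * P.M + 3) * (P.ℓ * P.d) + (P.κ + 4)) ∧
        totalBits (honest _) (dotPPre hash) σ₀ =
          P.m * (3 * P.ℓ) + 3 * (P.u * P.L + 2 * P.M + 3) * (P.ℓ * P.d) + 3 * (P.κ + 4) ∧
        (∃ F : Srv → Fin P.m → P.Z, (∀ p, (σ p).fLo = F p ∧ (σ p).fHi = F (p + 1)) ∧
          ∀ k, ∑ s, F s k = ∑ j, (∑ s, dv s k j) * (∑ s, ev s k j)) ∧
        (∀ p, (σ p).accepts p ∧ (σ p).jmp.ttp = none) ∧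
        ∀ (A : Adversary (PreSt P)) (σ' : Srv → PreSt P), totalBits A (dotPPre hash) σ' ≤
          P.m * (3 * P.ℓ) + 3 * (P.u * P.L + 2 * P.M + 3) * (P.ℓ * P.d) + 3 * (4 * P.κ + 25)) ∧
    -- The verification costs `O(√(nm))` elements of the extended ring.
    (∃ c : ℝ, 0 < c ∧ ∀ n m : ℕ, 1 ≤ n → 1 ≤ m →
      (n ≤ m → ∃ L M : ℕ, m ≤ L * M ∧
        3 * (((4 * n + 2) * L + 2 * M + 3 : ℕ) : ℝ) ≤ c * √((n : ℝ) * m)) ∧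
      ∀ L M : ℕ, (4 * n + 2) * L = 2 * M → m = L * M →
        3 * (((4 * n + 2) * L + 2 * M + 3 : ℕ) : ℝ) ≤ c * √((n : ℝ) * m)) ∧
    -- A cheating prover is accepted with probability about `2^(-(d-γ))`.
    (∀ P : Par, P.Valid → ∀ (x x' : Fin P.m → Slot P.n → P.Z) (b b' : Fin P.L → Slot P.n → P.E),
      (∀ θ, (∃ a, gCirc θ (grouped P (fun k s => x k s + x' k s) a) ≠ 0) → ∀ c c',
        cheatProbGiven P θ x x' b b' c c' ≤ errBound P.ℓ P.d P.M (2 * P.M)) ∧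
      (Cheats P x x' →
        prob {θ | ∀ a, gCirc θ (grouped P (fun k s => x k s + x' k s) a) = 0} ≤
          ((2 : ℝ) ^ P.d)⁻¹ ∧
        ∀ c c', cheatProb P x x' b b' c c' ≤
          ((2 : ℝ) ^ P.d)⁻¹ + errBound P.ℓ P.d P.M (2 * P.M)) ∧
      ∀ γ : ℕ, 2 * P.M ≤ 2 ^ γ →
        errBound P.ℓ P.d P.M (2 * P.M) ≤ errBound P.ℓ P.d P.M (2 ^ γ)) ∧
    (∀ ℓ : ℕ, 1 ≤ ℓ → ∀ M γ d : ℕ → ℕ, (∀ i, 2 * M i ≤ 2 ^ γ i) → Tendsto γ atTop atTop →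
      Tendsto (fun i => (d i : ℝ) - γ i) atTop atTop →
        Tendsto (fun i => errBound ℓ (d i) (M i) (2 ^ γ i) / (2 : ℝ) ^ (-((d i : ℝ) - γ i)))
          atTop (𝓝 1) ∧
        Tendsto (fun i => (((2 : ℝ) ^ d i)⁻¹ + errBound ℓ (d i) (M i) (2 ^ γ i)) /
          (2 : ℝ) ^ (-((d i : ℝ) - γ i))) atTop (𝓝 1)) ∧
    -- Amortized cost of the preprocessing: `3ℓ` bits for every vector length and security level.
    (∀ ℓ κ n sec : ℕ, 1 ≤ ℓ → ∃ P : ℕ → Par,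
      (∀ m, 1 ≤ m → (P m).Valid ∧ (P m).ℓ = ℓ ∧ (P m).κ = κ ∧ (P m).n = n ∧ (P m).m = m ∧
        ∀ x x' b b' c c', Cheats (P m) x x' →
          cheatProb (P m) x x' b b' c c' ≤ ((2 : ℝ) ^ sec)⁻¹) ∧
      ∃ total worst : ℕ → ℕ, Amortizes total (3 * ℓ) ∧ Amortizes worst (3 * ℓ) ∧
        ∀ m, 1 ≤ m → ∀ hash : VMsg (P m) → Dig (P m).κ,
          (∀ dv ev τ, totalBits (honest _) (dotPPre hash) (preInit dv ev τ) = total m) ∧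
          ∀ A σ', totalBits A (dotPPre hash) σ' ≤ worst m) ∧
    -- Online phase: one round for each layer of dot products, and `3ℓ` bits for each dot product.
    (∀ P : Par, P.Valid → ∀ (hashE : VMsg P → Dig P.κ) (hash : (Fin P.m → P.Z) → Dig P.κ)
      (T I : ℕ) (K : DotCircuit P.n P.m T I) (v : Fin I ⊕ Fin P.m → P.Z), K.Computes v →
      ∀ (mask : Srv → Fin I ⊕ Fin P.m → P.Z) (τ : Tape P),
        let σ := run (honest _) (dotPPre hashE)
          (preInit (fun s g j => mask s (K.left g j)) (fun s g j => mask s (K.right g j)) τ)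
        let ρ := onInit mask (fun x => v (.inl x) + (mask 0 (.inl x) + mask 1 (.inl x))) σ
        let ρ' := run (honest _) (online K hash) ρ
        (online (κ := P.κ) K hash).length = T + 13 ∧
        totalBits (honest _) (online K hash) ρ = P.m * (3 * P.ℓ) + 3 * (P.κ + 4) ∧
        Shared mask ρ' v ∧ (∀ p, (ρ' p).jmp.ttp = none) ∧
        (∀ t : ℕ, t ≤ T → ∀ g, (K.layer g : ℕ) < t → ∀ p : Srv, p ≠ 0 →
          (run (honest _) ((online K hash).take t) ρ p).val (.inr g) =
            v (.inr g) + (mask 0 (.inr g) + mask 1 (.inr g))) ∧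
        ∀ (A : Adversary (OnSt P.ℓ P.κ P.m I)) (ρ'' : Srv → OnSt P.ℓ P.κ P.m I),
          totalBits A (online K hash) ρ'' ≤ P.m * (3 * P.ℓ) + 3 * (4 * P.κ + 25)) ∧
    (∀ ℓ κ : ℕ, Amortizes (fun m => m * (3 * ℓ) + 3 * (κ + 4)) (3 * ℓ) ∧
      Amortizes (fun m => m * (3 * ℓ) + 3 * (4 * κ + 25)) (3 * ℓ)) ∧
    Amortizes (fun T => T + 13) 1 := by
  refine ⟨fun P hP => ⟨bitLen_Z, hP.bitLen_E, fun hash dv ev τ => ?_⟩,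
    ⟨57, by norm_num, fun n m hn hm => ⟨exists_group_size hn hm,
      fun L M => cost_of_balanced hn hm⟩⟩,
    fun P hP x x' b b' => ⟨hP.cheatProbGiven_le x x' b b',
      fun h => ⟨hP.prob_gCirc_eq_zero_le _ h, hP.cheatProb_le x x' b b' h⟩,
      fun γ h => hP.errBound_mono (by exact_mod_cast h)⟩,
    fun ℓ hℓ M γ d hM hγ hd => ⟨tendsto_errBound_ratio hℓ hM hγ hd,
      tendsto_inv_add_errBound_ratio hℓ hM hγ hd⟩,
    fun ℓ κ n sec hℓ => exists_amortized_parameters ℓ κ n sec hℓ,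
    fun P hP hashE hash T I K v hv mask τ => ?_, fun ℓ κ => ?_, ?_⟩
  · obtain ⟨c, J, hJ, hrun⟩ := run_dotPPre dv ev τ hash
    refine ⟨bits_semiHonest _, fun p => ?_, totalBits_dotPPre dv ev τ hP hash,
      ⟨fun p => (preInit dv ev τ p).share, fun p => ?_, sum_share dv ev τ⟩, fun p => ?_,
      hP.costLe_dotPPre hash⟩
    · rw [run_semiHonest]
      exact bits_verification dv ev τ hP hash p
    · rw [hrun]
      exact ⟨rfl, rfl⟩
    · rw [hrun]
      exact ⟨accepts_after dv ev τ hP p (c p) (J p), hJ p⟩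
  · obtain ⟨c, J, -, hrun⟩ := run_dotPPre (fun s g j => mask s (K.left g j))
      (fun s g j => mask s (K.right g j)) τ hashE
    -- The masks `[α]_2, [α]_1, γ` of a wire are the three additive shares of `γ + α`, so the
    -- preprocessing run on them yields shares of exactly the dot products that `masked_gate` needs.
    have hF := sum_share (fun s g j => mask s (K.left g j)) (fun s g j => mask s (K.right g j)) τ
    dsimp only
    rw [hrun, onInit_eq K mask v (fun s => (preInit (fun s g j => mask s (K.left g j))
      (fun s g j => mask s (K.right g j)) τ s).share) _ fun p => ⟨rfl, rfl⟩]
    obtain ⟨J', hJ', hrun'⟩ := run_online (κ := P.κ) K hv hF hash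
    refine ⟨length_online K hash, totalBits_online K hv hF hash, ?_, fun p => ?_,
      fun t ht g hg p hp => val_take_online K hv hF hash ht hg hp, costLe_online K hash⟩
    · rw [hrun']
      exact shared_delivered K J'
    · rw [hrun']
      exact hJ' p
  · have h := fun b => amortizes_add_const (3 * ℓ) b
    push_cast at h
    exact ⟨h _, h _⟩
  · simpa using amortizes_add_const 1 13
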